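/- Let $k$ be a field, $R=k[x,y]$, $B=(x,y)$, and let $f_1,\dots,f_r\in R$ be homogeneous polynomials of the same degree $d\ge 1$ without common factor. They define a morphism $\psi:\mathbb P^1_k\to\mathbb P^{r-1}_k$, $(x:y)\mapsto(f_1:\cdots:f_r)$. Let $I=(f_1,\dots,f_r)$ and $A=k[T_1,\dots,T_r]$. Let $\Phi$ be an $r\times(r-1)$ matrix over $R$ whose columns form a basis of the syzygy module $\{a\in R^r:\sum_i a_if_i=0\}$, the entries of the $j$-th column being homogeneous of degree $\mu_j\ge 0$; equivalently $$0\to\bigoplus_{j=1}^{r-1}R(-d-\mu_j)\xrightarrow{\ \Phi\ }R(-d)^r\xrightarrow{(f_1,\dots,f_r)}I\to 0$$ is a graded free resolution. Put $L_j=\sum_i\Phi_{ij}T_i\in A[x,y]$; these are the equations of $\mathrm{Sym}_R(I)$. Grade $\mathrm{Sym}_R(I)=A[x,y]/(L_1,\dots,L_{r-1})$ by $\deg x=\deg y=1$, $\deg T_i=0$. For an integer $\nu$ let $\mathbb M_\nu$ be the matrix, in any $A$-bases of these free modules, of the multiplication map $$\bigoplus_{j=1}^{r-1}A[x,y]_{\nu-\mu_j}\to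 A[x,y]_\nu,\qquad (g_j)_j\mapsto\sum_j L_jg_j .$$ Let $\nu$ be an integer with $\nu\ge\max_{i\ne j}(\mu_i+\mu_j)$; if $r=2$, where there is no pair $i\neq j$, let $\nu\ge d=\mu_1$. Then $$H^0_B(\mathrm{Sym}_R(I))_\nu=H^1_B(\mathrm{Sym}_R(I))_\nu=0 .$$ Moreover, for every field extension $K/k$ and every $K$-point $p$ of $\mathbb P^{r-1}_k$ (in particular for every point $p$ of the scheme $\mathbb P^{r-1}_k$, with $K$ its residue field), the scheme-theoretic fiber $\psi^{-1}(p)$ (a subscheme of $\mathbb P^1_K$) is finite over $K$, possibly empty, and $$\mathrm{corank}\,\mathbb M_\nu(p)=\deg\psi^{-1}(p),$$ where the corank is the number of rows minus the rank, and $\deg\psi^{-1}(p)$ is the dimension over $K$ of the ring of global functions of $\psi^{-1}(p)$. -/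

import Mathlib

open MvPolynomial

noncomputable section

namespace CurveFibers

/-! ### Graded local cohomology with respect to `(x, y)` through the Čech complex -/

section Cech

variable {R : Type*} [CommRing R]

/-- On `M_{gh}` the elements of `{1, g, g², …}` act invertibly when `g` divides `h`. -/
theorem isUnit_powers_of_dvd (M : Type*) [AddCommGroup M] [Module R M] {g h : R} (hgh : g ∣ h)
    (s : Submonoid.powers g) :
    IsUnit (algebraMap R (Module.End R (LocalizedModule (Submonoid.powers h) M)) s) := by
  obtain ⟨c, rfl⟩ := hgh
  obtain ⟨_, n, rfl⟩ := s
  have h1 : IsUnit (algebraMap R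
      (Module.End R (LocalizedModule (Submonoid.powers (g * c)) M)) ((g * c) ^ n)) :=
    IsLocalizedModule.map_units (LocalizedModule.mkLinearMap (Submonoid.powers (g * c)) M)
      (⟨(g * c) ^ n, n, rfl⟩ : Submonoid.powers (g * c))
  rw [mul_pow, map_mul] at h1
  exact (Commute.isUnit_mul_iff ((Commute.all (g ^ n) (c ^ n)).map (algebraMap R _))).mp h1 |>.1

/-- The localization map `M_g → M_h` for `g ∣ h`. -/
def awayMap (M : Type*) [AddCommGroup M] [Module R M] {g h : R} (hgh : g ∣ h) :
    LocalizedModule (Submonoid.powers g) M →ₗ[R] LocalizedModule (Submonoid.powers h) M :=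
  LocalizedModule.lift (Submonoid.powers g)
    (LocalizedModule.mkLinearMap (Submonoid.powers h) M) (isUnit_powers_of_dvd M hgh)

variable (x y : R) (M : Type*) [AddCommGroup M] [Module R M]

/-- The first map `M → M_x × M_y`, `m ↦ (m/1, m/1)`, of the Čech complex
`0 → M → M_x × M_y → M_{xy} → 0`. -/
def cechD0 : M →ₗ[R]
    LocalizedModule (Submonoid.powers x) M × LocalizedModule (Submonoid.powers y) M :=
  (LocalizedModule.mkLinearMap (Submonoid.powers x) M).prod
    (LocalizedModule.mkLinearMap (Submonoid.powers y) M)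

/-- The second map `M_x × M_y → M_{xy}`, `(a, b) ↦ b - a`, of the Čech complex. -/
def cechD1 : (LocalizedModule (Submonoid.powers x) M × LocalizedModule (Submonoid.powers y) M)
    →ₗ[R] LocalizedModule (Submonoid.powers (x * y)) M :=
  (awayMap M (Dvd.intro_left x rfl)).comp (LinearMap.snd R _ _) -
    (awayMap M (Dvd.intro y rfl)).comp (LinearMap.fst R _ _)

variable {M} (𝓜 : ℤ → AddSubgroup M)

/-- For a graded module `M = ⨁ M_n` and `g` of degree one, the piece `(M_g)_ν` of degree `ν`
of the localization: the fractions `m / g ^ n` with `m ∈ M_{ν + n}`. -/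
def awayPiece (g : R) (ν : ℤ) : AddSubgroup (LocalizedModule (Submonoid.powers g) M) :=
  AddSubgroup.closure {z | ∃ (n : ℕ) (m : M), m ∈ 𝓜 (ν + n) ∧
    z = LocalizedModule.mk m (⟨g ^ n, n, rfl⟩ : Submonoid.powers g)}

/-- `H⁰_{(x,y)}(M)_ν`, for `x`, `y` of degree one: kernel of the Čech complex in degree `ν`. -/
def localH0 (ν : ℤ) : AddSubgroup M :=
  𝓜 ν ⊓ (LinearMap.ker (cechD0 x y M)).toAddSubgroup

/-- Degree `ν` one-cocycles of the Čech complex. -/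
def cechZ1 (ν : ℤ) : AddSubgroup
    (LocalizedModule (Submonoid.powers x) M × LocalizedModule (Submonoid.powers y) M) :=
  (awayPiece 𝓜 x ν).prod (awayPiece 𝓜 y ν) ⊓ (LinearMap.ker (cechD1 x y M)).toAddSubgroup

/-- Degree `ν` one-coboundaries of the Čech complex. -/
def cechB1 (ν : ℤ) : AddSubgroup
    (LocalizedModule (Submonoid.powers x) M × LocalizedModule (Submonoid.powers y) M) :=
  (𝓜 ν).map (cechD0 x y M).toAddMonoidHom

/-- `H¹_{(x,y)}(M)_ν`, for `x`, `y` of degree one: cocycles modulo coboundaries. -/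
abbrev LocalH1 (ν : ℤ) : Type _ :=
  cechZ1 x y 𝓜 ν ⧸ (cechB1 x y 𝓜 ν).addSubgroupOf (cechZ1 x y 𝓜 ν)

end Cech

/-! ### Forms in two variables -/

/-- `A[x,y]_n`, the forms of degree `n` in two variables over `A`, for any integer `n`
(it is zero for `n < 0`). It is an `A`-submodule of `A[x,y]`. -/
def forms (A : Type*) [CommRing A] (n : ℤ) : Submodule A (MvPolynomial (Fin 2) A) :=
  restrictSupport A {m | (m.degree : ℤ) = n}

theorem mem_forms {A : Type*} [CommRing A] {n : ℤ} {g : MvPolynomial (Fin 2) A} :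
    g ∈ forms A n ↔ ∀ m ∈ g.support, (m.degree : ℤ) = n := by
  rw [forms, mem_restrictSupport_iff]
  rfl

theorem mul_mem_forms {A : Type*} [CommRing A] {a b : ℤ} {g h : MvPolynomial (Fin 2) A}
    (hg : g ∈ forms A a) (hh : h ∈ forms A b) : g * h ∈ forms A (a + b) := by
  classical
  rw [mem_forms] at *
  intro m hm
  obtain ⟨u, hu, v, hv, rfl⟩ := Finset.mem_add.mp (support_mul g h hm)
  rw [map_add, Nat.cast_add, hg u hu, hh v hv]

/-! ### Syzygies, the symmetric algebra and the matrices `M_ν` -/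

section Curve

variable {k : Type*} [Field k] {r : ℕ}

/-- The columns of `Φ` form a basis of the module of syzygies
`{a ∈ R^r | ∑ a_i f_i = 0}`, `R = k[x,y]`, the `j`-th column consisting of forms of degree `μ j`.
Equivalently, `0 → ⨁ R(-d-μ_j) → R(-d)^r → I → 0`, with first map `Φ` and second map given
by the forms `f_i` of degree `d`, is a graded free resolution of the ideal `I` of the `f_i`. -/
structure IsSyzygyBasis (f : Fin r → MvPolynomial (Fin 2) k) (μ : Fin (r - 1) → ℕ)
    (Φ : Matrix (Fin r) (Fin (r - 1)) (MvPolynomial (Fin 2) k)) : Prop where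
  homogeneous : ∀ i j, (Φ i j).IsHomogeneous (μ j)
  linearIndependent : LinearIndependent (MvPolynomial (Fin 2) k) Φ.col
  span_eq : Submodule.span (MvPolynomial (Fin 2) k) (Set.range Φ.col) =
    LinearMap.ker (Fintype.linearCombination (MvPolynomial (Fin 2) k) f)

/-- The equations `L_j = ∑ i, Φ_ij T_i` of the symmetric algebra, in `A[x,y]` where
`A = k[T_1, …, T_r]`. -/
def symEquation (Φ : Matrix (Fin r) (Fin (r - 1)) (MvPolynomial (Fin 2) k)) (j : Fin (r - 1)) :
    MvPolynomial (Fin 2) (MvPolynomial (Fin r) k) :=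
  ∑ i, MvPolynomial.map MvPolynomial.C (Φ i j) * MvPolynomial.C (MvPolynomial.X i)

theorem symEquation_mem {Φ : Matrix (Fin r) (Fin (r - 1)) (MvPolynomial (Fin 2) k)}
    {μ : Fin (r - 1) → ℕ} (hΦ : ∀ i j, (Φ i j).IsHomogeneous (μ j)) (j : Fin (r - 1)) :
    symEquation Φ j ∈ forms (MvPolynomial (Fin r) k) (μ j) := by
  refine Submodule.sum_mem _ fun i _ => ?_
  rw [mul_comm, ← smul_eq_C_mul]
  refine Submodule.smul_mem _ _ ?_
  rw [mem_forms]
  intro m hm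
  have h := hΦ i j (MvPolynomial.mem_support_iff.mp (support_map_subset _ _ hm))
  rw [Finsupp.degree_eq_weight_one]
  exact_mod_cast h

/-- The multiplication map `⨁_j A[x,y]_{ν - μ_j} → A[x,y]_ν`, `(g_j) ↦ ∑ L_j g_j`, of free
`A`-modules, `A = k[T_1, …, T_r]`. The matrix `M_ν` is its matrix in any bases. -/
def mulMap {Φ : Matrix (Fin r) (Fin (r - 1)) (MvPolynomial (Fin 2) k)}
    {μ : Fin (r - 1) → ℕ} (hΦ : ∀ i j, (Φ i j).IsHomogeneous (μ j)) (ν : ℤ) :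
    (∀ j, forms (MvPolynomial (Fin r) k) (ν - μ j)) →ₗ[MvPolynomial (Fin r) k]
      forms (MvPolynomial (Fin r) k) ν :=
  LinearMap.codRestrict _
    (∑ j, (LinearMap.mulLeft (MvPolynomial (Fin r) k) (symEquation Φ j)).comp
      ((Submodule.subtype _).comp (LinearMap.proj j)))
    (fun g => by
      rw [LinearMap.sum_apply]
      refine Submodule.sum_mem _ fun j _ => ?_
      simpa using mul_mem_forms (symEquation_mem hΦ j) (g j).2)

/-- The corank of a matrix over a field: the number of its rows minus its rank, that is, the
dimension of the cokernel of the linear map it defines. -/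
def corank {K m n : Type*} [Field K] [Fintype m] [Fintype n] (M : Matrix m n K) : ℕ :=
  Fintype.card m - M.rank

/-- The surjection `A[x,y] = R[T_1, …, T_r] → Sym_R(I)`, `T_i ↦ f_i ∈ I`, where `R = k[x,y]` and
`I = (f_1, …, f_r)`. -/
def toSym (f : Fin r → MvPolynomial (Fin 2) k) :
    MvPolynomial (Fin 2) (MvPolynomial (Fin r) k) →+*
      SymmetricAlgebra (MvPolynomial (Fin 2) k) (Ideal.span (Set.range f)) :=
  eval₂Hom
    (eval₂Hom ((algebraMap (MvPolynomial (Fin 2) k) _).comp MvPolynomial.C)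
      (fun i => SymmetricAlgebra.ι _ _ ⟨f i, Ideal.subset_span ⟨i, rfl⟩⟩))
    (fun l => algebraMap (MvPolynomial (Fin 2) k) _ (MvPolynomial.X l))

/-- The piece `Sym_R(I)_ν` of degree `ν` with respect to `x, y`; here `x, y` have degree `1` and
the generators `f_i ∈ I` of the symmetric algebra have degree `0`. -/
def symPiece (f : Fin r → MvPolynomial (Fin 2) k) (ν : ℤ) :
    AddSubgroup (SymmetricAlgebra (MvPolynomial (Fin 2) k) (Ideal.span (Set.range f))) :=
  (forms (MvPolynomial (Fin r) k) ν).toAddSubgroup.map (toSym f).toAddMonoidHom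

end Curve

/-! ### Fibers of the morphism -/

section Fiber

attribute [local instance] MvPolynomial.gradedAlgebra

variable {K : Type*} [Field K] {r d : ℕ}

/-- For forms `f_1, …, f_r` of degree `d` in `K[x,y]` defining `ψ : ℙ¹ → ℙ^{r-1}` and a
`K`-point `p` of `ℙ^{r-1}` with `p_i ≠ 0`: the ideal of the scheme-theoretic preimage `ψ⁻¹(p)`.
As `p` lies in the chart `T_i ≠ 0`, where it is defined by the equations `T_j/T_i = p_j/p_i`, its
preimage lies in the affine open set `D₊(f_i) = Spec K[x,y]_(f_i)`, where it is defined by the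
equations `f_j/f_i = p_j/p_i`, that is, `(p_i f_j - p_j f_i)/f_i = 0`. -/
def fiberIdeal (f : Fin r → MvPolynomial (Fin 2) K) (hf : ∀ i, (f i).IsHomogeneous d)
    (p : Fin r → K) (i : Fin r) :
    Ideal (HomogeneousLocalization.Away (homogeneousSubmodule (Fin 2) K) (f i)) :=
  Ideal.span (Set.range fun j =>
    HomogeneousLocalization.Away.mk (homogeneousSubmodule (Fin 2) K) (hf i) 1
      (p i • f j - p j • f i)
      (by
        rw [one_smul]
        exact Submodule.sub_mem _ (Submodule.smul_mem _ _ (hf j)) (Submodule.smul_mem _ _ (hf i))))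

/-- The coordinate ring of the affine scheme `ψ⁻¹(p)`, computed in the chart `T_i ≠ 0`. -/
def FiberRing (f : Fin r → MvPolynomial (Fin 2) K) (hf : ∀ i, (f i).IsHomogeneous d)
    (p : Fin r → K) (i : Fin r) : Type _ :=
  HomogeneousLocalization.Away (homogeneousSubmodule (Fin 2) K) (f i) ⧸ fiberIdeal f hf p i

instance (f : Fin r → MvPolynomial (Fin 2) K) (hf : ∀ i, (f i).IsHomogeneous d)
    (p : Fin r → K) (i : Fin r) : CommRing (FiberRing f hf p i) :=
  inferInstanceAs (CommRing
    (HomogeneousLocalization.Away (homogeneousSubmodule (Fin 2) K) (f i) ⧸ fiberIdeal f hf p i))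

/-- The structure of a `K`-algebra: `K` maps to the fractions of degree zero as constants. -/
instance (f : Fin r → MvPolynomial (Fin 2) K) (hf : ∀ i, (f i).IsHomogeneous d)
    (p : Fin r → K) (i : Fin r) : Algebra K (FiberRing f hf p i) :=
  RingHom.toAlgebra ((Ideal.Quotient.mk (fiberIdeal f hf p i)).comp
    ((algebraMap (homogeneousSubmodule (Fin 2) K 0)
      (HomogeneousLocalization.Away (homogeneousSubmodule (Fin 2) K) (f i))).comp
        (algebraMap K (homogeneousSubmodule (Fin 2) K 0))))

end Fiber

end CurveFibers

end

noncomputable section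

namespace CurveFibers

/-! ### Forms of integer degree -/

section Forms

variable {A : Type*} [CommRing A]

/-! Vanishing. Since the `f_i` have no common factor, `I` contains powers of `x` and `y`
(`exists_X_pow_mem`). Where `x` is invertible, `I` is the unit ideal, its resolution splits, and the
`L_j` become part of a system of variables; so every syzygy of the `L_j` becomes Koszul after
multiplication by a power of `x` (`IsSyzygyBasis.exists_isKoszul`). Now the Koszul complex is
compared with the Čech complex: a class in `H⁰_B` of degree `ν` is obstructed only by coefficients
in `H²_B(A[x,y])` of degrees `ν - μ_j - μ_l`, `j ≠ l`, and a class in `H¹_B` by coefficients of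
degrees `ν - μ_j`. As `H²_B(A[x,y])` vanishes in degrees `≥ -1` (`exists_split`), both groups are
zero. This is done with elements in `mem_span_of_X_pow_mul_mem` and `exists_forms_of_cocycle`.

Corank. Let `ℓ_l` be the value of `L_l` at `p`, and `h` the greatest common divisor of the `ℓ_l`, of
degree `e`. The quotients `ℓ_l / h` generate an ideal containing powers of `x` and `y`, and the same
saturation argument over `K` shows that it contains all forms of degree `≥ ν - e`. So the image of
`M_ν(p)` consists of all multiples of `h` of degree `ν`, and its codimension is `e`.

Fiber. The minors `p_i f_j - p_j f_i` and the `ℓ_l` generate the same ideal up to powers of `x`, `y`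
and a factor `f_i` (`X_pow_mul_minor_mem`, `mul_fiberEquation_mem`), so `h` is the equation of the
fiber. Modulo `h`, multiplication by `f_i` is injective, and it is surjective in large degrees; the
coordinate ring of the fiber is therefore a space of forms of large degree modulo multiples of `h`,
of dimension `e` (`finrank_fiberRing`). -/

theorem forms_iff_isHomogeneous {n : ℕ} {g : MvPolynomial (Fin 2) A} :
    g ∈ forms A (n : ℤ) ↔ g.IsHomogeneous n := by
  rw [mem_forms]
  simp only [IsHomogeneous, IsWeightedHomogeneous, mem_support_iff, Nat.cast_inj,
    Finsupp.degree_eq_weight_one]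
  rfl

theorem forms_of_neg {n : ℤ} (hn : n < 0) {g : MvPolynomial (Fin 2) A} (hg : g ∈ forms A n) :
    g = 0 := by
  rw [mem_forms] at hg
  rw [← support_eq_empty, Finset.eq_empty_iff_forall_notMem]
  intro m hm
  have := hg m hm
  omega

theorem monomial_mem_forms (m : Fin 2 →₀ ℕ) (c : A) {n : ℤ} (h : (m.degree : ℤ) = n) :
    monomial m c ∈ forms A n := by
  rw [mem_forms]
  intro m' hm'
  rw [Finset.mem_singleton.mp (support_monomial_subset hm'), h]

theorem X_pow_mem_forms (l : Fin 2) (N : ℕ) : (X l ^ N : MvPolynomial (Fin 2) A) ∈ forms A N :=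
  forms_iff_isHomogeneous.mpr (isHomogeneous_X_pow l N)

theorem X_pow_mul_mem_forms (l : Fin 2) (N : ℕ) {n s : ℤ} {g : MvPolynomial (Fin 2) A}
    (hg : g ∈ forms A n) (h : n + N = s) : X l ^ N * g ∈ forms A s := by
  rw [← h, add_comm]
  exact mul_mem_forms (X_pow_mem_forms l N) hg

/-- The projection of `A[x,y]` onto the forms of degree `n`. -/
def degProj (A : Type*) [CommRing A] (n : ℤ) :
    MvPolynomial (Fin 2) A →ₗ[A] MvPolynomial (Fin 2) A :=
  if 0 ≤ n then homogeneousComponent n.toNat else 0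

theorem coeff_degProj (n : ℤ) (g : MvPolynomial (Fin 2) A) (m : Fin 2 →₀ ℕ) :
    coeff m (degProj A n g) = if (m.degree : ℤ) = n then coeff m g else 0 := by
  rw [degProj]
  split_ifs with h1 h2 h2
  · rw [coeff_homogeneousComponent, if_pos (by omega)]
  · rw [coeff_homogeneousComponent, if_neg (by omega)]
  · omega
  · simp

theorem degProj_mem (n : ℤ) (g : MvPolynomial (Fin 2) A) : degProj A n g ∈ forms A n := by
  rw [mem_forms]
  intro m hm
  rw [mem_support_iff, coeff_degProj] at hm
  by_contra h
  exact hm (if_neg h)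

theorem degProj_of_mem {n : ℤ} {g : MvPolynomial (Fin 2) A} (hg : g ∈ forms A n) :
    degProj A n g = g := by
  ext m
  rw [coeff_degProj]
  split_ifs with h
  · rfl
  · rw [mem_forms] at hg
    by_contra h'
    exact h (hg m (mem_support_iff.mpr (Ne.symm h')))

theorem degProj_of_mem_ne {a n : ℤ} {g : MvPolynomial (Fin 2) A} (hg : g ∈ forms A a)
    (h : a ≠ n) : degProj A n g = 0 := by
  ext m
  rw [coeff_degProj]
  split_ifs with h'
  · rw [mem_forms] at hg
    by_contra h''
    exact h ((hg m (mem_support_iff.mpr h'')).symm.trans h')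
  · simp

theorem degProj_mul {a b : ℤ} (u : MvPolynomial (Fin 2) A) {L : MvPolynomial (Fin 2) A}
    (hL : L ∈ forms A b) : degProj A (a + b) (u * L) = degProj A a u * L := by
  induction u using MvPolynomial.induction_on' with
  | monomial m c =>
    by_cases h : (m.degree : ℤ) = a
    · have hm := monomial_mem_forms m c h
      rw [degProj_of_mem (mul_mem_forms hm hL), degProj_of_mem hm]
    · have hm := monomial_mem_forms m c rfl
      rw [degProj_of_mem_ne (mul_mem_forms hm hL) (by omega), degProj_of_mem_ne hm h, zero_mul]
  | add p q hp hq => rw [add_mul, map_add, map_add, hp, hq, add_mul]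

/-- Every element of an ideal generated by forms which is a form is a combination with forms as
coefficients. -/
theorem exists_forms_coeff {ι : Type*} [Fintype ι] {L : ι → MvPolynomial (Fin 2) A} {m : ι → ℤ}
    (hL : ∀ j, L j ∈ forms A (m j)) {s : ℤ} {g : MvPolynomial (Fin 2) A} (hg : g ∈ forms A s)
    (h : g ∈ Ideal.span (Set.range L)) :
    ∃ a : ι → MvPolynomial (Fin 2) A, (∀ j, a j ∈ forms A (s - m j)) ∧ g = ∑ j, a j * L j := by
  obtain ⟨a, ha⟩ := (Ideal.mem_span_range_iff_exists_fun).mp h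
  refine ⟨fun j => degProj A (s - m j) (a j), fun j => degProj_mem _ _, ?_⟩
  rw [← degProj_of_mem hg, ← ha, map_sum]
  refine Finset.sum_congr rfl fun j _ => ?_
  rw [← degProj_mul (a j) (hL j), sub_add_cancel]

/-- A form of degree at least `2N - 1` lies in the ideal `(x ^ N, y ^ N)`. -/
theorem exists_split {N : ℕ} {t : ℤ} (ht : 2 * (N : ℤ) - 1 ≤ t) {c : MvPolynomial (Fin 2) A}
    (hc : c ∈ forms A t) : ∃ c₁ c₂, c₁ ∈ forms A (t - N) ∧ c₂ ∈ forms A (t - N) ∧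
      c = X 1 ^ N * c₁ - X 0 ^ N * c₂ := by
  rw [forms, restrictSupport_eq_span] at hc
  induction hc using Submodule.span_induction with
  | mem g hg =>
    obtain ⟨m, hm, rfl⟩ := hg
    have hdeg : (m.degree : ℤ) = t := hm
    rw [Finsupp.degree_eq_sum, Fin.sum_univ_two] at hdeg
    have key : ∀ l, N ≤ m l → ∃ c₁ ∈ forms A (t - N), monomial m (1 : A) = X l ^ N * c₁ := by
      intro l hl
      have hle : Finsupp.single l N ≤ m := by
        simpa using hl
      refine ⟨monomial (m - Finsupp.single l N) 1, monomial_mem_forms _ _ ?_, ?_⟩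
      · have h1 : (m - Finsupp.single l N).degree + N = m.degree := by
          conv_rhs => rw [← tsub_add_cancel_of_le hle]
          rw [map_add, Finsupp.degree_single]
        have h2 : (m.degree : ℤ) = t := hm
        omega
      · rw [X_pow_eq_monomial, monomial_mul, one_mul, add_tsub_cancel_of_le hle]
    -- Two exponents below `N` add up to at most `2N - 2`, so one of them is at least `N`. The signs
    -- are those of the Čech differential.
    by_cases h1 : N ≤ m 1
    · obtain ⟨c₁, hc₁, h⟩ := key 1 h1
      exact ⟨c₁, 0, hc₁, zero_mem _, by simpa using h⟩
    · obtain ⟨c₂, hc₂, h⟩ := key 0 (by push_cast at hdeg; omega)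
      exact ⟨0, -c₂, zero_mem _, neg_mem hc₂, by simpa using h⟩
  | zero => exact ⟨0, 0, zero_mem _, zero_mem _, by simp⟩
  | add p q _ _ hp hq =>
    obtain ⟨a, b, ha, hb, rfl⟩ := hp
    obtain ⟨a', b', ha', hb', rfl⟩ := hq
    exact ⟨a + a', b + b', add_mem ha ha', add_mem hb hb', by ring⟩
  | smul r p _ hp =>
    obtain ⟨a, b, ha, hb, rfl⟩ := hp
    exact ⟨r • a, r • b, Submodule.smul_mem _ _ ha, Submodule.smul_mem _ _ hb, by
      rw [smul_sub, mul_smul_comm, mul_smul_comm]⟩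

variable [IsDomain A]

theorem X_zero_not_dvd_X_one_pow {N : ℕ} :
    ¬ (X 0 : MvPolynomial (Fin 2) A) ∣ X 1 ^ N := by
  intro h
  have := X_prime.dvd_of_dvd_pow h
  rw [X_dvd_X] at this
  exact zero_ne_one this

/-- Cancelling `h` gives `y ^ N u = x ^ N v`, so `x ^ N` divides `u` because `x` is prime and does
not divide `y ^ N`. -/
theorem dvd_of_X_pow_mul_dvd {N : ℕ} {h a u v : MvPolynomial (Fin 2) A} (hu : h * u = X 0 ^ N * a)
    (hv : h * v = X 1 ^ N * a) : h ∣ a := by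
  rcases eq_or_ne h 0 with rfl | h0
  · rw [zero_mul, eq_comm, mul_eq_zero] at hu
    rw [hu.resolve_left (pow_ne_zero _ (X_ne_zero 0))]
  have h1 : X 1 ^ N * u = X 0 ^ N * v := by
    apply mul_left_cancel₀ h0
    linear_combination X 1 ^ N * hu - X 0 ^ N * hv
  have h2 : (X 0 : MvPolynomial (Fin 2) A) ^ N ∣ u :=
    X_prime.pow_dvd_of_dvd_mul_left N X_zero_not_dvd_X_one_pow (Dvd.intro _ h1.symm)
  obtain ⟨u', rfl⟩ := h2
  refine ⟨u', mul_left_cancel₀ (pow_ne_zero N (X_ne_zero (0 : Fin 2))) ?_⟩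
  linear_combination -hu

/-- The vanishing of `H¹_B(A[x,y])`, written with numerators only. -/
theorem exists_of_X_pow_mul_eq {N : ℕ} {a b : MvPolynomial (Fin 2) A}
    (h : X 1 ^ N * a = X 0 ^ N * b) : ∃ g, a = X 0 ^ N * g ∧ b = X 1 ^ N * g := by
  have h2 : (X 0 : MvPolynomial (Fin 2) A) ^ N ∣ a :=
    X_prime.pow_dvd_of_dvd_mul_left N X_zero_not_dvd_X_one_pow (Dvd.intro _ h.symm)
  obtain ⟨g, rfl⟩ := h2
  refine ⟨g, rfl, mul_left_cancel₀ (pow_ne_zero N (X_ne_zero (0 : Fin 2))) ?_⟩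
  linear_combination -h

theorem mem_forms_of_mul_mem {a b : ℤ} {h g : MvPolynomial (Fin 2) A} (hh : h ∈ forms A b)
    (h0 : h ≠ 0) (hg : g * h ∈ forms A (a + b)) : g ∈ forms A a := by
  have := degProj_mul (a := a) g hh
  rw [degProj_of_mem hg] at this
  rw [mul_right_cancel₀ h0 this]
  exact degProj_mem _ _

end Forms

/-! ### Monomial bases and dimensions of the spaces of forms. -/

section Dimension

variable (A : Type*) [CommRing A]

/-- The monomials of degree `n` in two variables. -/
def degreeEquiv (n : ℕ) : {m : Fin 2 →₀ ℕ | (m.degree : ℤ) = (n : ℤ)} ≃ Fin (n + 1) where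
  toFun m := ⟨m.1 0, by
    have h : (m.1.degree : ℤ) = n := m.2
    rw [Finsupp.degree_eq_sum, Fin.sum_univ_two] at h
    omega⟩
  invFun i := ⟨Finsupp.single 0 i.1 + Finsupp.single 1 (n - i.1), by
    simp only [Set.mem_ofPred_eq, map_add, Finsupp.degree_single]
    omega⟩
  left_inv m := by
    have h : (m.1.degree : ℤ) = n := m.2
    rw [Finsupp.degree_eq_sum, Fin.sum_univ_two] at h
    ext l
    fin_cases l
    · simp
    · simp
      omega
  right_inv i := by
    ext
    simp

/-- The basis of monomials of `A[x,y]_n`. -/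
def formsBasis (n : ℕ) : Module.Basis (Fin (n + 1)) A (forms A (n : ℤ)) :=
  (basisRestrictSupport A _).reindex (degreeEquiv n)

theorem finrank_forms [Nontrivial A] (n : ℕ) : Module.finrank A (forms A (n : ℤ)) = n + 1 := by
  rw [Module.finrank_eq_card_basis (formsBasis A n), Fintype.card_fin]

end Dimension

/-! ### Koszul syzygies -/

section Koszul

variable {S : Type*} [CommRing S] {ι : Type*} [Fintype ι]

/-- The vector `c` is a combination of the Koszul syzygies `t_l e_j - t_j e_l` of the `t_j`. -/
def IsKoszul (t c : ι → S) : Prop :=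
  ∃ u : ι → ι → S, (∀ j l, u j l = -u l j) ∧ (∀ j, u j j = 0) ∧ ∀ j, c j = ∑ l, u j l * t l

theorem IsKoszul.mul_left {t c : ι → S} (h : IsKoszul t c) (a : S) :
    IsKoszul t (fun j => a * c j) := by
  obtain ⟨u, h1, h2, h3⟩ := h
  refine ⟨fun j l => a * u j l, fun j l => by simp only [h1 j l, mul_neg],
    fun j => by simp only [h2, mul_zero], fun j => ?_⟩
  simp only [h3, Finset.mul_sum]
  exact Finset.sum_congr rfl fun l _ => by ring

theorem IsKoszul.map {S' : Type*} [CommRing S'] (σ : S →+* S') {t c : ι → S} (h : IsKoszul t c) :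
    IsKoszul (fun j => σ (t j)) (fun j => σ (c j)) := by
  obtain ⟨u, h1, h2, h3⟩ := h
  refine ⟨fun j l => σ (u j l), fun j l => by simp only [h1 j l, map_neg],
    fun j => by simp only [h2, map_zero], fun j => ?_⟩
  simp only [h3, map_sum, map_mul]

/-- The terms at `(j, l)` and `(l, j)` cancel. The diagonal needs its own hypothesis, since
antisymmetry alone does not make it vanish in characteristic two. -/
theorem sum_alternating {t : ι → S} {u : ι → ι → S} (h1 : ∀ j l, u j l = -u l j)
    (h2 : ∀ j, u j j = 0) : ∑ j, (∑ l, u j l * t l) * t j = 0 := by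
  classical
  simp_rw [Finset.sum_mul]
  rw [← Finset.sum_product']
  refine Finset.sum_involution (fun p _ => (p.2, p.1)) ?_ ?_ ?_ ?_
  · rintro ⟨a, b⟩ -
    change u a b * t b * t a + u b a * t a * t b = 0
    rw [h1 a b]
    ring
  · rintro ⟨a, b⟩ - h hab
    simp only [Prod.mk.injEq] at hab
    rw [hab.1] at h
    simp [h2] at h
  · simp
  · simp

/-- Elements of the unit ideal: if `w = ∑ w_j t_j`, then `w` multiplies all syzygies into the
Koszul syzygies. -/
theorem isKoszul_of_sum_mul_eq {t c w : ι → S} (hc : ∑ j, c j * t j = 0) :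
    IsKoszul t (fun j => (∑ l, w l * t l) * c j) := by
  -- The standard Koszul homotopy given by `w`: contracting with `t` leaves `(∑ w_l t_l) c_j - w_j ∑
  -- c_l t_l`, and the last sum is zero.
  refine ⟨fun j l => w l * c j - w j * c l, fun j l => by ring, fun j => by ring, fun j => ?_⟩
  simp_rw [sub_mul, Finset.sum_sub_distrib, mul_assoc]
  rw [← Finset.mul_sum, hc, mul_zero, sub_zero, Finset.sum_mul]
  exact Finset.sum_congr rfl fun l _ => by ring

/-- Induction on a set `s` supporting the syzygy. Regularity puts the coefficient at a new index
into the ideal of the remaining `t_j`, so Koszul syzygies can be added to make it vanish. -/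
theorem isKoszul_of_regular [DecidableEq ι] (t : ι → S)
    (ht : ∀ (s : Finset ι), ∀ j ∉ s, ∀ c : S, c * t j ∈ Ideal.span (t '' s) →
      c ∈ Ideal.span (t '' s)) {c : ι → S} (hc : ∑ j, c j * t j = 0) : IsKoszul t c := by
  suffices H : ∀ (s : Finset ι) (c : ι → S), (∀ j ∉ s, c j = 0) → ∑ j, c j * t j = 0 →
      IsKoszul t c from H Finset.univ c (by simp) hc
  clear hc c
  intro s
  induction s using Finset.induction_on with
  | empty =>
    intro c hc _
    exact ⟨0, by simp, by simp, fun j => by simp [hc j]⟩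
  | insert a s ha ih =>
    intro c hcs hc
    have hsum : c a * t a + ∑ j ∈ s, c j * t j = 0 := by
      rw [← hc, ← Finset.sum_insert (f := fun j => c j * t j) ha]
      refine Finset.sum_subset (Finset.subset_univ _) fun j _ hj => ?_
      rw [hcs j hj, zero_mul]
    have hmem : c a ∈ Ideal.span (t '' s) := by
      refine ht s a ha _ ?_
      rw [eq_neg_of_add_eq_zero_left hsum]
      exact neg_mem (Ideal.sum_mem _ fun j hj =>
        Ideal.mul_mem_left _ _ (Ideal.subset_span ⟨j, hj, rfl⟩))
    obtain ⟨d, hds, hd⟩ : ∃ d : ι → S, (∀ j ∉ s, d j = 0) ∧ c a = ∑ j, d j * t j := by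
      rw [Ideal.span, Submodule.mem_span_image_finset_iff_exists_fun] at hmem
      obtain ⟨d, hd⟩ := hmem
      refine ⟨fun j => if h : j ∈ s then d ⟨j, h⟩ else 0, fun j hj => dif_neg hj, ?_⟩
      rw [← hd, ← Finset.sum_subset (Finset.subset_univ s), ← Finset.sum_coe_sort s]
      · exact Finset.sum_congr rfl fun j _ => by simp
      · intro j _ hj
        simp [hj]
    -- Adding the Koszul syzygies `d_j (t_a e_j - t_j e_a)` to `c` kills the entry at `a`; they are
    -- subtracted again in the final witness.
    obtain ⟨u, h1, h2, h3⟩ := ih (fun j => if j = a then 0 else c j + d j * t a) (by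
        intro j hj
        by_cases hja : j = a
        · simp [hja]
        · simp [hja, hds j hj, hcs j (by simp [hj, hja])]) (by
        have : ∀ j, (if j = a then 0 else c j + d j * t a) * t j =
            c j * t j + (d j * t j) * t a - if j = a then c a * t a else 0 := by
          intro j
          by_cases hja : j = a
          · simp [hja, hds a ha]
          · rw [if_neg hja, if_neg hja]
            ring
        simp_rw [this]
        rw [Finset.sum_sub_distrib, Finset.sum_add_distrib, hc, ← Finset.sum_mul, ← hd,
          Finset.sum_ite_eq' Finset.univ a, if_pos (Finset.mem_univ a), zero_add, sub_self])
    refine ⟨fun j l => u j l - (if l = a then d j else 0) + (if j = a then d l else 0),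
      fun j l => by simp only [h1 j l]; ring, fun j => by simp only [h2]; ring, fun j => ?_⟩
    simp only [add_mul, sub_mul, Finset.sum_add_distrib, Finset.sum_sub_distrib, ite_mul, zero_mul,
      Finset.sum_ite_eq', Finset.mem_univ, if_true]
    rw [← h3 j]
    by_cases hja : j = a
    · subst hja
      simp [hds j ha, hd]
    · simp [hja]

end Koszul

/-! ### The Koszul complex and saturation -/

section Saturation

variable {A : Type*} [CommRing A] [IsDomain A] {ι : Type*} [Fintype ι]
  {L : ι → MvPolynomial (Fin 2) A} {m : ι → ℤ}

/-- Degree `s` of `H⁰` of `A[x,y]/(L)` vanishes when the syzygies of `L` are Koszul outside of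
`V(x)` and `s ≥ m_j + m_l - 1` for `j ≠ l`. -/
theorem mem_span_of_X_pow_mul_mem (hL : ∀ j, L j ∈ forms A (m j)) {s : ℤ}
    (hs : ∀ j l, j ≠ l → m j + m l - 1 ≤ s)
    (hK : ∀ c : ι → MvPolynomial (Fin 2) A, ∑ j, c j * L j = 0 →
      ∃ M : ℕ, IsKoszul L (fun j => X 0 ^ M * c j))
    {g : MvPolynomial (Fin 2) A} (hg : g ∈ forms A s) {N : ℕ}
    (hx : X 0 ^ N * g ∈ Ideal.span (Set.range L)) (hy : X 1 ^ N * g ∈ Ideal.span (Set.range L)) :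
    g ∈ Ideal.span (Set.range L) := by
  classical
  obtain ⟨a, ha, hax⟩ := exists_forms_coeff hL (X_pow_mul_mem_forms 0 N hg rfl) hx
  obtain ⟨b, hb, hby⟩ := exists_forms_coeff hL (X_pow_mul_mem_forms 1 N hg rfl) hy
  -- The two expressions for `x ^ N y ^ N g` differ by a syzygy of `L`.
  obtain ⟨M, hM⟩ := hK (fun j => X 1 ^ N * a j - X 0 ^ N * b j) (by
    simp_rw [sub_mul, Finset.sum_sub_distrib, mul_assoc, ← Finset.mul_sum]
    rw [← hax, ← hby]
    ring)
  -- The extra factor `y ^ M` restores the symmetry: from here on `x` and `y` both occur with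
  -- exponent `N' = N + M`.
  obtain ⟨u, h1, h2, h3⟩ := hM.mul_left (X 1 ^ M)
  replace h3 : ∀ j, X 1 ^ M * (X 0 ^ M * (X 1 ^ N * a j - X 0 ^ N * b j)) =
      ∑ l, u j l * L l := h3
  set N' := N + M with hN'
  have hc : ∀ j, X 1 ^ M * (X 0 ^ M * (X 1 ^ N * a j - X 0 ^ N * b j)) ∈
      forms A (s + 2 * N' - m j) := by
    intro j
    refine X_pow_mul_mem_forms 1 M (X_pow_mul_mem_forms 0 M (sub_mem
      (X_pow_mul_mem_forms 1 N (ha j) rfl) (X_pow_mul_mem_forms 0 N (hb j) rfl)) rfl) ?_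
    push_cast [hN']
    ring
  set v : ι → ι → MvPolynomial (Fin 2) A :=
    fun j l => degProj A (s + 2 * N' - m j - m l) (u j l) with hv
  have h3' : ∀ j, X 1 ^ M * (X 0 ^ M * (X 1 ^ N * a j - X 0 ^ N * b j)) =
      ∑ l, v j l * L l := by
    intro j
    rw [← degProj_of_mem (hc j), h3, map_sum]
    refine Finset.sum_congr rfl fun l _ => ?_
    rw [hv, ← degProj_mul _ (hL l), sub_add_cancel]
  have hsplit : ∀ j l, ∃ p q : MvPolynomial (Fin 2) A,
      v j l = X 1 ^ N' * p - X 0 ^ N' * q ∧ (j = l → p = 0 ∧ q = 0) := by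
    intro j l
    by_cases hjl : j = l
    · exact ⟨0, 0, by simp [hv, hjl, h2], fun _ => ⟨rfl, rfl⟩⟩
    -- The degree `s + 2N' - m_j - m_l` is at least `2N' - 1`, which is exactly where the bound on
    -- `s` is used. The diagonal entries vanish, so nothing is needed about `2 m_j`.
    · obtain ⟨p, q, -, -, h⟩ := exists_split (N := N') (by have := hs j l hjl; omega)
        (degProj_mem (s + 2 * N' - m j - m l) (u j l))
      exact ⟨p, q, h, fun h => absurd h hjl⟩
  choose p q hpq hpq0 using hsplit
  -- antisymmetrize the splitting with the help of a linear order
  obtain ⟨e⟩ : Nonempty (ι ≃ Fin (Fintype.card ι)) := ⟨Fintype.equivFin ι⟩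
  have hanti : ∀ p : ι → ι → MvPolynomial (Fin 2) A,
      ∃ P : ι → ι → MvPolynomial (Fin 2) A, (∀ j l, P j l = -P l j) ∧ (∀ j, P j j = 0) ∧
        ∀ j l, e j < e l → P j l = p j l := by
    intro p
    refine ⟨fun j l => if e j < e l then p j l else if e l < e j then -p l j else 0, ?_, ?_, ?_⟩
    · intro j l
      rcases lt_trichotomy (e j) (e l) with h | h | h
      · simp [h, h.not_gt]
      · simp [h]
      · simp [h, h.not_gt]
    · simp
    · intro j l h
      simp [h]
  obtain ⟨P, hP1, hP2, hP3⟩ := hanti p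
  obtain ⟨Q, hQ1, hQ2, hQ3⟩ := hanti q
  have hvPQ : ∀ j l, v j l = X 1 ^ N' * P j l - X 0 ^ N' * Q j l := by
    intro j l
    rcases lt_trichotomy (e j) (e l) with h | h | h
    · rw [hP3 j l h, hQ3 j l h, hpq]
    · rw [e.injective h, hP2, hQ2, hv]
      simp [h2]
    · have hvl : v j l = -v l j := by
        simp only [hv]
        rw [h1 j l, map_neg]
        congr 2
        ring_nf
      rw [hP1, hQ1, hP3 l j h, hQ3 l j h, hvl, hpq]
      ring
  -- After correction by the alternating terms `P` and `Q`, the coefficient vectors satisfy the Čech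
  -- cocycle condition exactly, so both come from a common vector `h`.
  have hdiff : ∀ j, X 1 ^ N' * (X 0 ^ M * a j - ∑ l, P j l * L l) =
      X 0 ^ N' * (X 1 ^ M * b j - ∑ l, Q j l * L l) := by
    intro j
    have := h3' j
    simp_rw [hvPQ, sub_mul, Finset.sum_sub_distrib, mul_assoc, ← Finset.mul_sum] at this
    rw [hN', pow_add, pow_add] at *
    linear_combination this
  choose h hh _ using fun j => exists_of_X_pow_mul_eq (hdiff j)
  have hfin : X 0 ^ N' * g = X 0 ^ N' * ∑ j, h j * L j := by
    have e1 : X 0 ^ N' * g = ∑ j, (X 0 ^ M * a j) * L j := by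
      simp_rw [mul_assoc, ← Finset.mul_sum]
      rw [← hax, hN', pow_add]
      ring
    have e2 : ∑ j, (X 0 ^ N' * h j) * L j = X 0 ^ N' * ∑ j, h j * L j := by
      simp_rw [mul_assoc, ← Finset.mul_sum]
    -- The correction by `P` does not change the combination of the `L_j`, because `P` is
    -- alternating.
    rw [← e2, e1, ← sub_eq_zero, ← Finset.sum_sub_distrib, ← sum_alternating (t := L) hP1 hP2]
    refine Finset.sum_congr rfl fun j _ => ?_
    rw [← hh j]
    ring
  rw [mul_left_cancel₀ (pow_ne_zero _ (X_ne_zero _)) hfin]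
  exact Ideal.sum_mem _ fun j _ => Ideal.mul_mem_left _ _ (Ideal.subset_span ⟨j, rfl⟩)

/-- Degree `s` of `H¹` of `A[x,y]/(L)` vanishes when `s ≥ m_j - 1`. -/
theorem exists_forms_of_cocycle (hL : ∀ j, L j ∈ forms A (m j)) {s : ℤ}
    (hs : ∀ j, m j - 1 ≤ s) {N : ℕ} {a b : MvPolynomial (Fin 2) A}
    (ha : a ∈ forms A (s + N)) (hb : b ∈ forms A (s + N))
    (h : X 1 ^ N * a - X 0 ^ N * b ∈ Ideal.span (Set.range L)) :
    ∃ g ∈ forms A s, a - X 0 ^ N * g ∈ Ideal.span (Set.range L) ∧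
      b - X 1 ^ N * g ∈ Ideal.span (Set.range L) := by
  obtain ⟨c, hc, hsum⟩ := exists_forms_coeff hL (s := s + 2 * N)
    (sub_mem (X_pow_mul_mem_forms 1 N ha (by ring)) (X_pow_mul_mem_forms 0 N hb (by ring))) h
  -- Here `c_j` has degree `s + 2N - m_j ≥ 2N - 1`.
  choose c₁ c₂ hc₁ hc₂ hcc using fun j =>
    exists_split (N := N) (by have := hs j; omega) (hc j)
  have hd : X 1 ^ N * (a - ∑ j, c₁ j * L j) = X 0 ^ N * (b - ∑ j, c₂ j * L j) := by
    simp_rw [hcc, sub_mul, Finset.sum_sub_distrib, mul_assoc, ← Finset.mul_sum] at hsum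
    linear_combination hsum
  obtain ⟨g, hg1, hg2⟩ := exists_of_X_pow_mul_eq hd
  have hmem : ∀ c : ι → MvPolynomial (Fin 2) A, ∑ j, c j * L j ∈ Ideal.span (Set.range L) :=
    fun c => Ideal.sum_mem _ fun j _ => Ideal.mul_mem_left _ _ (Ideal.subset_span ⟨j, rfl⟩)
  refine ⟨g, ?_, ?_, ?_⟩
  · refine mem_forms_of_mul_mem (X_pow_mem_forms 0 N) (pow_ne_zero _ (X_ne_zero _)) ?_
    rw [mul_comm, ← hg1]
    refine sub_mem ha (Submodule.sum_mem _ fun j _ => ?_)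
    convert! mul_mem_forms (hc₁ j) (hL j) using 2
    ring
  · rw [← hg1]
    simpa using hmem c₁
  · rw [← hg2]
    simpa using hmem c₂

end Saturation

/-! ### Syzygies of the equations of the symmetric algebra -/

section SymmetricSyzygies

variable {k : Type*} [Field k]

/-- The homomorphism from `R[T]`, `R = k[x,y]`, to an `R`-algebra with given images of the `T_i`. -/
def evalHom {E τ : Type*} [CommRing E] (φ : MvPolynomial (Fin 2) k →+* E) (v : τ → E) :
    MvPolynomial (Fin 2) (MvPolynomial τ k) →+* E :=
  eval₂Hom (eval₂Hom (φ.comp C) v) (fun l => φ (X l))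

section evalHom

variable {E τ : Type*} [CommRing E] (φ : MvPolynomial (Fin 2) k →+* E) (v : τ → E)

@[simp]
theorem evalHom_map_C (g : MvPolynomial (Fin 2) k) :
    evalHom φ v (MvPolynomial.map C g) = φ g := by
  suffices h : (evalHom φ v).comp (MvPolynomial.map C) = φ from RingHom.congr_fun h g
  refine MvPolynomial.ringHom_ext (fun c => ?_) fun l => ?_ <;> simp [evalHom]

@[simp]
theorem evalHom_C_X (i : τ) : evalHom φ v (C (X i)) = v i := by
  simp [evalHom]

@[simp]
theorem evalHom_X (l : Fin 2) : evalHom φ v (X l) = φ (X l) := by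
  simp [evalHom]

theorem ringHom_ext_map_C {τ : Type*} {E : Type*} [CommRing E]
    {α β : MvPolynomial (Fin 2) (MvPolynomial τ k) →+* E}
    (h1 : ∀ g : MvPolynomial (Fin 2) k, α (MvPolynomial.map C g) = β (MvPolynomial.map C g))
    (h2 : ∀ i, α (C (X i)) = β (C (X i))) : α = β := by
  refine MvPolynomial.ringHom_ext' (MvPolynomial.ringHom_ext' ?_ h2) fun l => ?_
  · ext c
    simpa using h1 (C c)
  · simpa using h1 (X l)

end evalHom

/-- Any syzygy of distinct variables `T_j` over `A[x,y]`, `A = k[T]`, is Koszul. -/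
theorem isKoszul_variables {τ ι : Type*} [Fintype ι] [DecidableEq ι] {e : ι → τ}
    (he : Function.Injective e) {c : ι → MvPolynomial (Fin 2) (MvPolynomial τ k)}
    (hc : ∑ j, c j * C (X (e j)) = 0) : IsKoszul (fun j => C (X (e j))) c := by
  refine isKoszul_of_regular _ (fun s j hj c hcj => ?_) hc
  have hs : Ideal.span ((fun j => (C (X (e j)) : MvPolynomial (Fin 2) (MvPolynomial τ k))) '' s) =
      (Ideal.span (X '' (e '' s)) : Ideal (MvPolynomial τ k)).map C := by
    rw [Ideal.map_span, Set.image_image, Set.image_image]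
  rw [hs, mem_map_C_iff] at hcj ⊢
  intro m
  have h := hcj m
  rw [mul_comm, coeff_C_mul, mem_ideal_span_X_image] at h
  rw [mem_ideal_span_X_image]
  intro a ha
  -- The ideal is extended from a monomial ideal of `k[T]`. If `T_l` divides `T_j` times a monomial
  -- and `l ≠ j`, then it divides that monomial.
  obtain ⟨i, hi, h0⟩ := h (Finsupp.single (e j) 1 + a) (by
    rw [mem_support_iff, coeff_X_mul]
    exact mem_support_iff.mp ha)
  refine ⟨i, hi, ?_⟩
  obtain ⟨l, hl, rfl⟩ := hi
  have hjl : e j ≠ e l := fun h => hj (he h ▸ hl)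
  simpa [Finsupp.single_apply, hjl] using h0

variable {r : ℕ} {f : Fin r → MvPolynomial (Fin 2) k} {μ : Fin (r - 1) → ℕ}
  {Φ : Matrix (Fin r) (Fin (r - 1)) (MvPolynomial (Fin 2) k)}

theorem IsSyzygyBasis.col_sum (hΦ : IsSyzygyBasis f μ Φ) (l : Fin (r - 1)) :
    ∑ i, Φ i l * f i = 0 := by
  have h : Φ.col l ∈ Submodule.span (MvPolynomial (Fin 2) k) (Set.range Φ.col) :=
    Submodule.subset_span ⟨l, rfl⟩
  rw [hΦ.span_eq, LinearMap.mem_ker, Fintype.linearCombination_apply] at h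
  simpa using h

theorem IsSyzygyBasis.exists_coeff (hΦ : IsSyzygyBasis f μ Φ) {a : Fin r → MvPolynomial (Fin 2) k}
    (ha : ∑ i, a i * f i = 0) : ∃ w : Fin (r - 1) → MvPolynomial (Fin 2) k,
      ∀ i, a i = ∑ l, w l * Φ i l := by
  have h : a ∈ Submodule.span (MvPolynomial (Fin 2) k) (Set.range Φ.col) := by
    rw [hΦ.span_eq, LinearMap.mem_ker, Fintype.linearCombination_apply]
    simpa using ha
  obtain ⟨w, hw⟩ := (Submodule.mem_span_range_iff_exists_fun _).mp h
  refine ⟨w, fun i => ?_⟩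
  rw [← hw, Finset.sum_apply]
  rfl

theorem IsSyzygyBasis.eq_zero (hΦ : IsSyzygyBasis f μ Φ) {w : Fin (r - 1) → MvPolynomial (Fin 2) k}
    (h : ∀ i, ∑ l, w l * Φ i l = 0) (l : Fin (r - 1)) : w l = 0 := by
  refine Fintype.linearIndependent_iff.mp hΦ.linearIndependent w ?_ l
  ext1 i
  rw [Finset.sum_apply]
  exact h i

/-- An element `z = ∑ s_i f_i` of the ideal splits the resolution up to multiplication by `z`. -/
theorem IsSyzygyBasis.exists_splitting (hΦ : IsSyzygyBasis f μ Φ)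
    {s : Fin r → MvPolynomial (Fin 2) k} {z : MvPolynomial (Fin 2) k} (hs : ∑ i, s i * f i = z) :
    ∃ w : Fin r → Fin (r - 1) → MvPolynomial (Fin 2) k,
      (∀ i i', (if i = i' then z else 0) = f i * s i' + ∑ l, w i l * Φ i' l) ∧
      (∀ j l, ∑ i, Φ i j * w i l = if j = l then z else 0) ∧ ∀ l, ∑ i, s i * w i l = 0 := by
  -- The vector `z e_i - f_i s` is a syzygy of `f`, because `∑ s_i f_i = z`.
  choose w hw using fun i => hΦ.exists_coeff
    (a := fun i' => (if i = i' then z else 0) - f i * s i') (by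
      simp only [sub_mul, Finset.sum_sub_distrib, ite_mul, zero_mul, Finset.sum_ite_eq,
        Finset.mem_univ, if_true, mul_assoc, ← Finset.mul_sum, hs]
      ring)
  -- The same identity for an arbitrary vector `b`. Taking for `b` a column of `Φ`, then `s`, and
  -- comparing coefficients in the basis of syzygies gives the other two families of relations.
  have key : ∀ (b : Fin r → MvPolynomial (Fin 2) k) (i' : Fin r),
      b i' * z - (∑ i, b i * f i) * s i' = ∑ l, (∑ i, b i * w i l) * Φ i' l := by
    intro b i'
    have h1 : ∑ i, b i * ((if i = i' then z else 0) - f i * s i') =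
        ∑ i, b i * ∑ l, w i l * Φ i' l := Finset.sum_congr rfl fun i _ => by rw [← hw]
    simp only [mul_sub, Finset.sum_sub_distrib, mul_ite, mul_zero, Finset.sum_ite_eq',
      Finset.mem_univ, if_true, ← mul_assoc, ← Finset.sum_mul] at h1
    rw [h1]
    simp_rw [Finset.mul_sum, Finset.sum_mul]
    rw [Finset.sum_comm]
    exact Finset.sum_congr rfl fun l _ => Finset.sum_congr rfl fun i _ => by ring
  refine ⟨w, fun i i' => by rw [← hw]; ring, fun j l => ?_, fun l => ?_⟩
  · rw [← sub_eq_zero]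
    refine hΦ.eq_zero (w := fun l => ∑ i, Φ i j * w i l - if j = l then z else 0) (fun i' => ?_) l
    have := key (fun i => Φ i j) i'
    rw [hΦ.col_sum] at this
    simp only [sub_mul, Finset.sum_sub_distrib, ← this, ite_mul, zero_mul, Finset.sum_ite_eq,
      Finset.mem_univ, if_true]
    ring
  · refine hΦ.eq_zero (w := fun l => ∑ i, s i * w i l) (fun i' => ?_) l
    rw [← key s i', hs]
    ring

/-- Koszul syzygies and a ring homomorphism which becomes an isomorphism after inverting `x`. -/
theorem exists_isKoszul_of_injective {S S' ι : Type*} [CommRing S] [CommRing S'] [Fintype ι]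
    {σ : S' →+* S} (hinj : Function.Injective σ) {x : S'}
    (hsurj : ∀ a, ∃ (D : ℕ) (a' : S'), σ a' = σ x ^ D * a) {t : ι → S'}
    (ht : ∀ c : ι → S', ∑ j, c j * t j = 0 → IsKoszul t c) {c : ι → S}
    (hc : ∑ j, c j * σ (t j) = 0) :
    ∃ D : ℕ, IsKoszul (fun j => σ (t j)) (fun j => σ x ^ D * c j) := by
  classical
  choose D c' hc' using fun j => hsurj (c j)
  refine ⟨∑ j, D j, ?_⟩
  -- All entries are brought to the common exponent `∑ D_j`, so that a single syzygy lifts along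
  -- `σ`.
  have hc'' : ∀ j, σ (x ^ (∑ i ∈ Finset.univ.erase j, D i) * c' j) = σ x ^ (∑ j, D j) * c j := by
    intro j
    rw [map_mul, map_pow, hc', ← mul_assoc, ← pow_add,
      Finset.sum_erase_add _ _ (Finset.mem_univ j)]
  have h := (ht (fun j => x ^ (∑ i ∈ Finset.univ.erase j, D i) * c' j) (hinj (by
    rw [map_sum, map_zero]
    simp_rw [map_mul σ (_ * _), hc'', mul_assoc]
    rw [← Finset.mul_sum, hc, mul_zero]))).map σ
  simpa only [hc''] using h

/-- The homomorphism sending the variables to the `L_j` and to one more linear form. -/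
def coordHom (Φ : Matrix (Fin r) (Fin (r - 1)) (MvPolynomial (Fin 2) k))
    (s : Fin r → MvPolynomial (Fin 2) k) :
    MvPolynomial (Fin 2) (MvPolynomial (Option (Fin (r - 1))) k) →+*
      MvPolynomial (Fin 2) (MvPolynomial (Fin r) k) :=
  evalHom (MvPolynomial.map C) (fun o =>
    o.elim (∑ i, MvPolynomial.map C (s i) * C (X i)) (symEquation Φ))

/-- The linear forms which `coordHom` sends to multiples of the variables. -/
def coordForm (f : Fin r → MvPolynomial (Fin 2) k)
    (w : Fin r → Fin (r - 1) → MvPolynomial (Fin 2) k) (i : Fin r) :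
    MvPolynomial (Fin 2) (MvPolynomial (Option (Fin (r - 1))) k) :=
  MvPolynomial.map C (f i) * C (X none) + ∑ l, MvPolynomial.map C (w i l) * C (X (some l))

/-- The image is `f_i ∑ s_{i'} T_{i'} + ∑ w_{il} L_l`; the relation `hw` says that its coefficient
at `T_{i'}` is `z` if `i' = i` and `0` otherwise. -/
theorem coordHom_coordForm {s : Fin r → MvPolynomial (Fin 2) k} {z : MvPolynomial (Fin 2) k}
    {w : Fin r → Fin (r - 1) → MvPolynomial (Fin 2) k}
    (hw : ∀ i i', (if i = i' then z else 0) = f i * s i' + ∑ l, w i l * Φ i' l) (i : Fin r) :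
    coordHom Φ s (coordForm f w i) = MvPolynomial.map C z * C (X i) := by
  simp only [coordHom, coordForm, map_add, map_mul, map_sum, evalHom_map_C, evalHom_C_X,
    Option.elim_none, Option.elim_some, symEquation, Finset.mul_sum]
  rw [Finset.sum_comm, ← Finset.sum_add_distrib, Finset.sum_eq_single i]
  · have h := congrArg (MvPolynomial.map (C : k →+* MvPolynomial (Fin r) k)) (hw i i)
    rw [if_pos rfl, map_add, map_mul, map_sum] at h
    simp_rw [map_mul] at h
    simp_rw [← mul_assoc]
    rw [← Finset.sum_mul, ← add_mul, ← h]
  · intro i' _ hi'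
    have h := congrArg (MvPolynomial.map (C : k →+* MvPolynomial (Fin r) k)) (hw i i')
    rw [if_neg (Ne.symm hi'), map_add, map_mul, map_sum, map_zero] at h
    simp_rw [map_mul] at h
    simp_rw [← mul_assoc]
    rw [← Finset.sum_mul, ← add_mul, ← h, zero_mul]
  · simp

/-- Each `T_i` times `x ^ M` is the image of `coordForm f w i`, and the elements that enter the
image after multiplication by a power of `x` are closed under sums and under products with the
variables. -/
theorem coordHom_surjective_away {s : Fin r → MvPolynomial (Fin 2) k} {M : ℕ}
    {w : Fin r → Fin (r - 1) → MvPolynomial (Fin 2) k}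
    (hw : ∀ i i', (if i = i' then X 0 ^ M else 0) = f i * s i' + ∑ l, w i l * Φ i' l)
    (a : MvPolynomial (Fin 2) (MvPolynomial (Fin r) k)) :
    ∃ (D : ℕ) (a' : _), coordHom Φ s a' = coordHom Φ s (X 0) ^ D * a := by
  have hX : ∀ l, coordHom Φ s (X l) = X l := fun l => by
    rw [coordHom, evalHom_X, MvPolynomial.map_X]
  rw [hX]
  have hadd : ∀ p q : MvPolynomial (Fin 2) (MvPolynomial (Fin r) k),
      (∃ (D : ℕ) (a' : _), coordHom Φ s a' = X 0 ^ D * p) →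
      (∃ (D : ℕ) (a' : _), coordHom Φ s a' = X 0 ^ D * q) →
      ∃ (D : ℕ) (a' : _), coordHom Φ s a' = X 0 ^ D * (p + q) := by
    rintro p q ⟨D, p', hp⟩ ⟨D', q', hq⟩
    refine ⟨D + D', X 0 ^ D' * p' + X 0 ^ D * q', ?_⟩
    rw [map_add, map_mul, map_mul, map_pow, map_pow, hX, hp, hq]
    ring
  induction a using MvPolynomial.induction_on with
  | C a =>
    induction a using MvPolynomial.induction_on with
    | C c =>
      refine ⟨0, MvPolynomial.map C (C c), ?_⟩
      rw [coordHom, evalHom_map_C, MvPolynomial.map_C, pow_zero, one_mul]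
    | add p q hp hq => rw [C_add]; exact hadd _ _ hp hq
    | mul_X p i hp =>
      obtain ⟨D, p', hp⟩ := hp
      refine ⟨D + M, p' * coordForm f w i, ?_⟩
      rw [map_mul, hp, coordHom_coordForm hw, C_mul, map_pow, MvPolynomial.map_X]
      ring
  | add p q hp hq => exact hadd _ _ hp hq
  | mul_X p l hp =>
    obtain ⟨D, p', hp⟩ := hp
    refine ⟨D, p' * X l, ?_⟩
    rw [map_mul, hp, hX]
    ring

/-- A left inverse exists once `z` is inverted: it sends `T_i` to `coordForm f w i / z`. Its target
is the fraction field of the source of `coordHom`. -/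
theorem coordHom_injective {s : Fin r → MvPolynomial (Fin 2) k} {z : MvPolynomial (Fin 2) k}
    {w : Fin r → Fin (r - 1) → MvPolynomial (Fin 2) k} (hz : z ≠ 0) (hs : ∑ i, s i * f i = z)
    (hcol : ∀ l, ∑ i, Φ i l * f i = 0)
    (hw2 : ∀ j l, ∑ i, Φ i j * w i l = if j = l then z else 0)
    (hw3 : ∀ l, ∑ i, s i * w i l = 0) : Function.Injective (coordHom Φ s) := by
  obtain ⟨E, _, ψ, hψ⟩ : ∃ (E : Type _) (_ : Field E)
      (ψ : MvPolynomial (Fin 2) (MvPolynomial (Option (Fin (r - 1))) k) →+* E),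
      Function.Injective ψ :=
    ⟨FractionRing (MvPolynomial (Fin 2) (MvPolynomial (Option (Fin (r - 1))) k)), inferInstance,
      algebraMap _ _, IsFractionRing.injective _ _⟩
  have hz' : ψ (MvPolynomial.map C z) ≠ 0 := by
    rw [Ne, map_eq_zero_iff ψ hψ, map_eq_zero_iff _ (map_injective _ (C_injective _ _))]
    exact hz
  set κ : MvPolynomial (Fin 2) (MvPolynomial (Fin r) k) →+* E :=
    evalHom (ψ.comp (MvPolynomial.map C))
      (fun i => ψ (coordForm f w i) / ψ (MvPolynomial.map C z)) with hκdef
  have hκ : ∀ b : Fin r → MvPolynomial (Fin 2) k,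
      κ (∑ i, MvPolynomial.map C (b i) * C (X i)) =
        ψ (MvPolynomial.map C (∑ i, b i * f i) * C (X none) +
          ∑ l, MvPolynomial.map C (∑ i, b i * w i l) * C (X (some l))) /
            ψ (MvPolynomial.map C z) := by
    intro b
    simp only [hκdef, evalHom_map_C, evalHom_C_X, RingHom.comp_apply,
      map_sum, map_mul]
    simp_rw [← mul_div_assoc, ← map_mul]
    rw [← Finset.sum_div, ← map_sum]
    congr 2
    simp only [coordForm, mul_add, Finset.sum_add_distrib, Finset.mul_sum, Finset.sum_mul, map_mul]
    congr 1
    · exact Finset.sum_congr rfl fun i _ => by ring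
    · rw [Finset.sum_comm]
      exact Finset.sum_congr rfl fun i _ => Finset.sum_congr rfl fun l _ => by ring
  have hcomp : κ.comp (coordHom Φ s) = ψ := by
    refine ringHom_ext_map_C (fun g => ?_) fun o => ?_
    · rw [RingHom.comp_apply, coordHom, evalHom_map_C, hκdef, evalHom_map_C, RingHom.comp_apply]
    · rw [RingHom.comp_apply, coordHom, evalHom_C_X]
      cases o with
      | none =>
        rw [Option.elim_none, hκ, div_eq_iff hz', ← map_mul, hs]
        simp only [hw3, map_zero, zero_mul, Finset.sum_const_zero, add_zero]
        rw [mul_comm]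
      | some j =>
        rw [Option.elim_some, symEquation, hκ, div_eq_iff hz', ← map_mul, hcol]
        congr 1
        -- The coefficient of the additional variable vanishes as the column is a syzygy; the others
        -- are `z` times the Kronecker delta.
        rw [map_zero, zero_mul, zero_add, Finset.sum_eq_single j]
        · rw [hw2, if_pos rfl, mul_comm]
        · intro l _ hl
          rw [hw2, if_neg (Ne.symm hl), map_zero, zero_mul]
        · simp
  rw [← hcomp, RingHom.coe_comp] at hψ
  exact hψ.of_comp

/-- Where `x` is invertible, the `L_j` are part of a system of variables. -/
theorem IsSyzygyBasis.exists_isKoszul (hΦ : IsSyzygyBasis f μ Φ) {M : ℕ}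
    (hM : X 0 ^ M ∈ Ideal.span (Set.range f))
    {c : Fin (r - 1) → MvPolynomial (Fin 2) (MvPolynomial (Fin r) k)}
    (hc : ∑ j, c j * symEquation Φ j = 0) :
    ∃ D : ℕ, IsKoszul (symEquation Φ) (fun j => X 0 ^ D * c j) := by
  obtain ⟨s, hs⟩ := Ideal.mem_span_range_iff_exists_fun.mp hM
  obtain ⟨w, hw1, hw2, hw3⟩ := hΦ.exists_splitting hs
  have ht : ∀ j, coordHom Φ s (C (X (some j))) = symEquation Φ j := fun j => by
    rw [coordHom, evalHom_C_X, Option.elim_some]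
  have hX : coordHom Φ s (X 0) = X 0 := by rw [coordHom, evalHom_X, MvPolynomial.map_X]
  have h := exists_isKoszul_of_injective (t := fun j => C (X (some j))) (c := c)
    (coordHom_injective (pow_ne_zero _ (X_ne_zero _)) hs hΦ.col_sum hw2 hw3)
    (coordHom_surjective_away hw1)
    (fun c hc => isKoszul_variables (Option.some_injective _) hc) (by simpa only [ht] using hc)
  simpa only [ht, hX] using h

end SymmetricSyzygies

/-! ### Common divisors of binary forms -/

section Dehomogenization

variable {K : Type*} [Field K]

/-- Dehomogenization `g ↦ g(t, 1)`. -/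
def dehom (K : Type*) [Field K] : MvPolynomial (Fin 2) K →ₐ[K] Polynomial K :=
  aeval ![Polynomial.X, 1]

/-- Homogenization in degree `n`. -/
def homog (n : ℕ) (q : Polynomial K) : MvPolynomial (Fin 2) K :=
  ∑ i ∈ Finset.range (n + 1), C (q.coeff i) * (X 0 ^ i * X 1 ^ (n - i))

theorem homog_isHomogeneous (n : ℕ) (q : Polynomial K) : (homog n q).IsHomogeneous n := by
  refine IsHomogeneous.sum _ _ _ fun i hi => ?_
  refine IsHomogeneous.C_mul ?_ _
  have := (isHomogeneous_X_pow (R := K) (0 : Fin 2) i).mul (isHomogeneous_X_pow 1 (n - i))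
  rwa [Nat.add_sub_of_le (by simpa [Nat.lt_succ_iff] using hi)] at this

theorem dehom_homog {n : ℕ} {q : Polynomial K} (hq : q.natDegree ≤ n) :
    dehom K (homog n q) = q := by
  conv_rhs => rw [q.as_sum_range_C_mul_X_pow' (Nat.lt_succ_of_le hq)]
  simp [homog, dehom]

theorem homog_dehom {n : ℕ} {g : MvPolynomial (Fin 2) K} (hg : g.IsHomogeneous n) :
    homog n (dehom K g) = g ∧ (dehom K g).natDegree ≤ n := by
  have hg' := forms_iff_isHomogeneous.mpr hg
  rw [forms, restrictSupport_eq_span] at hg'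
  clear hg
  induction hg' using Submodule.span_induction with
  | mem g h =>
    obtain ⟨m, hm, rfl⟩ := h
    have hdeg : (m.degree : ℤ) = n := hm
    rw [Finsupp.degree_eq_sum, Fin.sum_univ_two] at hdeg
    have h1 : dehom K (monomial m 1) = Polynomial.X ^ m 0 := by
      rw [dehom, aeval_monomial, Finsupp.prod_fintype _ _ (by simp)]
      simp
    rw [h1]
    refine ⟨?_, by rw [Polynomial.natDegree_X_pow]; omega⟩
    rw [homog, Finset.sum_eq_single (m 0)]
    · rw [Polynomial.coeff_X_pow_self, C_1, one_mul]
      beta_reduce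
      rw [monomial_eq, C_1, one_mul, Finsupp.prod_fintype _ _ (by simp), Fin.prod_univ_two]
      congr 2
      omega
    · intro i _ hi
      rw [Polynomial.coeff_X_pow, if_neg hi, C_0, zero_mul]
    · intro h
      exact absurd (Finset.mem_range.mpr (by omega)) h
  | zero => simp [homog]
  | add p q _ _ hp hq =>
    refine ⟨?_, ?_⟩
    · conv_rhs => rw [← hp.1, ← hq.1]
      simp [homog, add_mul, Finset.sum_add_distrib]
    · rw [map_add]
      exact (Polynomial.natDegree_add_le _ _).trans (max_le hp.2 hq.2)
  | smul c p _ hp =>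
    refine ⟨?_, ?_⟩
    · conv_rhs => rw [← hp.1]
      simp [homog, smul_eq_C_mul, Finset.mul_sum, mul_assoc]
    · rw [map_smul]
      exact (Polynomial.natDegree_smul_le _ _).trans hp.2

theorem dehom_injOn {n : ℕ} {g h : MvPolynomial (Fin 2) K} (hg : g.IsHomogeneous n)
    (hh : h.IsHomogeneous n) (H : dehom K g = dehom K h) : g = h := by
  rw [← (homog_dehom hg).1, H, (homog_dehom hh).1]

/-- Binary forms either have a common divisor of positive degree, or generate a power of `y`. -/
theorem exists_common_divisor_or_X_one_pow_mem {ι : Type*} [Fintype ι]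
    {ℓ : ι → MvPolynomial (Fin 2) K} {m : ι → ℕ} (hℓ : ∀ j, (ℓ j).IsHomogeneous (m j)) :
    (∃ e q, 0 < e ∧ q.IsHomogeneous e ∧ ∀ j, q ∣ ℓ j) ∨
      ∃ N : ℕ, X 1 ^ N ∈ Ideal.span (Set.range ℓ) := by
  -- Setting `y = 1` moves the question to the principal ideal domain `K[t]`. Powers of `y` are lost
  -- in the process, hence the alternative that only concerns `y`.
  set I : Ideal (Polynomial K) := Ideal.span (Set.range fun j => dehom K (ℓ j)) with hI
  set q := Submodule.IsPrincipal.generator I with hq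
  have hqdvd : ∀ j, q ∣ dehom K (ℓ j) := fun j =>
    (Submodule.IsPrincipal.mem_iff_generator_dvd I).mp (Ideal.subset_span ⟨j, rfl⟩)
  by_cases hu : IsUnit q
  · right
    have h1 : (1 : Polynomial K) ∈ I := by
      rw [Ideal.eq_top_of_isUnit_mem I (Submodule.IsPrincipal.generator_mem I) hu]
      trivial
    obtain ⟨w, hw⟩ := Ideal.mem_span_range_iff_exists_fun.mp h1
    -- Large enough for every `w_j` to be homogenized in degree `N - m_j`.
    set N := ∑ j, (m j + (w j).natDegree) with hN
    have hle : ∀ j, m j + (w j).natDegree ≤ N := fun j =>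
      Finset.single_le_sum (f := fun j => m j + (w j).natDegree) (fun _ _ => Nat.zero_le _)
        (Finset.mem_univ j)
    refine ⟨N, ?_⟩
    have : X 1 ^ N = ∑ j, homog (N - m j) (w j) * ℓ j := by
      refine dehom_injOn (isHomogeneous_X_pow 1 N) (IsHomogeneous.sum _ _ _ fun j _ => ?_) ?_
      · have := (homog_isHomogeneous (N - m j) (w j)).mul (hℓ j)
        rwa [Nat.sub_add_cancel ((Nat.le_add_right _ _).trans (hle j))] at this
      · rw [map_sum, map_pow]
        simp_rw [map_mul]
        rw [show dehom K (X 1) = 1 by simp [dehom], one_pow, ← hw]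
        refine Finset.sum_congr rfl fun j _ => ?_
        rw [dehom_homog (by have := hle j; omega)]
    rw [this]
    exact Ideal.sum_mem _ fun j _ => Ideal.mul_mem_left _ _ (Ideal.subset_span ⟨j, rfl⟩)
  · left
    rcases eq_or_ne q 0 with h0 | h0
    -- All the forms are zero here, so any form of positive degree is a common divisor.
    · refine ⟨1, X 0, one_pos, isHomogeneous_X _ _, fun j => ?_⟩
      have hz : dehom K (ℓ j) = dehom K 0 := by
        rw [map_zero]
        exact zero_dvd_iff.mp (h0 ▸ hqdvd j)
      rw [dehom_injOn (hℓ j) (isHomogeneous_zero _ _ _) hz]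
      exact dvd_zero _
    · refine ⟨q.natDegree, homog q.natDegree q, ?_, homog_isHomogeneous _ _, fun j => ?_⟩
      · rw [Nat.pos_iff_ne_zero]
        intro h
        rw [Polynomial.natDegree_eq_zero] at h
        obtain ⟨c, hc⟩ := h
        refine hu (hc ▸ Polynomial.isUnit_C.mpr (isUnit_iff_ne_zero.mpr ?_))
        rintro rfl
        rw [map_zero] at hc
        exact h0 hc.symm
      · obtain ⟨c, hc⟩ := hqdvd j
        rcases eq_or_ne c 0 with rfl | hc0
        · rw [mul_zero, ← map_zero (dehom K)] at hc
          rw [dehom_injOn (hℓ j) (isHomogeneous_zero _ _ _) hc]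
          exact dvd_zero _
        have hdeg := (homog_dehom (hℓ j)).2
        rw [hc, Polynomial.natDegree_mul h0 hc0] at hdeg
        refine ⟨homog (m j - q.natDegree) c, dehom_injOn (hℓ j) ?_ ?_⟩
        · have := (homog_isHomogeneous q.natDegree q).mul
            (homog_isHomogeneous (m j - q.natDegree) c)
          rwa [Nat.add_sub_of_le (by omega)] at this
        · rw [map_mul, dehom_homog le_rfl, dehom_homog (by omega), hc]

/-- Binary forms either have a common divisor of positive degree, or generate an ideal which is
primary to `(x, y)`. -/
theorem exists_common_divisor_or_X_pow_mem {ι : Type*} [Fintype ι]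
    {ℓ : ι → MvPolynomial (Fin 2) K} {m : ι → ℕ} (hℓ : ∀ j, (ℓ j).IsHomogeneous (m j)) :
    (∃ e q, 0 < e ∧ q.IsHomogeneous e ∧ ∀ j, q ∣ ℓ j) ∨
      ∃ N : ℕ, ∀ l, X l ^ N ∈ Ideal.span (Set.range ℓ) := by
  rcases exists_common_divisor_or_X_one_pow_mem hℓ with h | ⟨N, hN⟩
  · exact Or.inl h
  -- Exchanging the variables gives the corresponding power of `x`.
  let ρ := renameEquiv K (Equiv.swap (0 : Fin 2) 1)
  have hρρ : ∀ g, ρ (ρ g) = g := fun g => by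
    simp only [ρ, renameEquiv_apply, rename_rename]
    rw [show (⇑(Equiv.swap (0 : Fin 2) 1) ∘ ⇑(Equiv.swap (0 : Fin 2) 1)) = id by
      ext x; simp, rename_id_apply]
  have hρhom : ∀ g n, g.IsHomogeneous n → (ρ g).IsHomogeneous n := fun g n hg => by
    simpa [ρ] using hg.rename_isHomogeneous
  rcases exists_common_divisor_or_X_one_pow_mem (fun j => hρhom _ _ (hℓ j)) with
    ⟨e, q, he, hq, hdvd⟩ | ⟨N', hN'⟩
  · exact Or.inl ⟨e, ρ q, he, hρhom _ _ hq, fun j => by simpa [hρρ] using map_dvd ρ (hdvd j)⟩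
  · right
    have h := Ideal.mem_map_of_mem ρ hN'
    rw [Ideal.map_span, ← Set.range_comp, map_pow] at h
    simp only [Function.comp_def, hρρ] at h
    rw [show ρ (X 1) = X 0 by simp [ρ]] at h
    refine ⟨N' + N, fun l => ?_⟩
    fin_cases l
    · simp only [Fin.zero_eta, pow_add]
      exact Ideal.mul_mem_right _ _ h
    · simp only [Fin.mk_one, pow_add]
      exact Ideal.mul_mem_left _ _ hN

theorem not_isUnit_of_isHomogeneous {e : ℕ} (he : 0 < e) {q : MvPolynomial (Fin 2) K}
    (hq : q.IsHomogeneous e) : ¬ IsUnit q := by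
  intro h
  refine not_isUnit_zero (M₀ := K) ?_
  convert! h.map (constantCoeff (σ := Fin 2) (R := K)) using 1
  rw [constantCoeff_eq, hq.coeff_eq_zero (by simpa using he.ne)]

theorem exists_X_pow_mem {ι : Type*} [Fintype ι] {f : ι → MvPolynomial (Fin 2) K} {d : ℕ}
    (hf : ∀ j, (f j).IsHomogeneous d) (hcop : ∀ g, (∀ i, g ∣ f i) → IsUnit g) :
    ∃ N : ℕ, ∀ l, X l ^ N ∈ Ideal.span (Set.range f) := by
  rcases exists_common_divisor_or_X_pow_mem hf with ⟨e, q, he, hq, hdvd⟩ | h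
  · exact absurd (hcop q hdvd) (not_isUnit_of_isHomogeneous he hq)
  · exact h

/-- Binary forms have a greatest common divisor `h`, and the quotients by `h` generate an ideal
which is primary to `(x, y)`. -/
theorem exists_gcd_forms {ι : Type*} [Fintype ι] {ℓ : ι → MvPolynomial (Fin 2) K} {m : ι → ℕ}
    (hℓ : ∀ j, (ℓ j).IsHomogeneous (m j)) (h0 : ∃ j, ℓ j ≠ 0) :
    ∃ (e : ℕ) (h : MvPolynomial (Fin 2) K) (ℓ' : ι → MvPolynomial (Fin 2) K),
      h.IsHomogeneous e ∧ h ≠ 0 ∧ (∃ j, e ≤ m j) ∧ (∀ j, ℓ j = ℓ' j * h) ∧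
      (∀ j, ℓ' j ∈ forms K (m j - e)) ∧ ∃ N : ℕ, ∀ l, X l ^ N ∈ Ideal.span (Set.range ℓ') := by
  obtain ⟨j₀, hj₀⟩ := h0
  -- A common divisor of maximal degree `e` is taken; degrees are bounded by that of a nonzero form.
  -- A common divisor of positive degree of the quotients would contradict maximality.
  set D : Set ℕ := {e | ∃ h : MvPolynomial (Fin 2) K, h.IsHomogeneous e ∧ ∀ j, h ∣ ℓ j} with hD
  have hle : ∀ e ∈ D, e ≤ m j₀ := by
    rintro e ⟨h, hh, hdvd⟩
    obtain ⟨c, hc⟩ := hdvd j₀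
    have hne : h ≠ 0 ∧ c ≠ 0 := mul_ne_zero_iff.mp (hc ▸ hj₀)
    have := totalDegree_mul_of_isDomain hne.1 hne.2
    rw [← hc, (hℓ j₀).totalDegree hj₀, hh.totalDegree hne.1] at this
    omega
  have hbdd : BddAbove D := ⟨m j₀, hle⟩
  have hmem : sSup D ∈ D := Nat.sSup_mem ⟨0, 1, isHomogeneous_one _ _, fun j => one_dvd _⟩ hbdd
  set e := sSup D
  obtain ⟨h, hh, hdvd⟩ := id hmem
  choose ℓ' hℓ' using fun j => (hdvd j)
  have hne : h ≠ 0 := left_ne_zero_of_mul (hℓ' j₀ ▸ hj₀)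
  have hforms : ∀ j, ℓ' j ∈ forms K (m j - e) := by
    intro j
    refine mem_forms_of_mul_mem (forms_iff_isHomogeneous.mpr hh) hne ?_
    rw [sub_add_cancel, mul_comm, ← hℓ' j]
    exact forms_iff_isHomogeneous.mpr (hℓ j)
  refine ⟨e, h, ℓ', hh, hne, ⟨j₀, hle e hmem⟩, fun j => by rw [hℓ', mul_comm], hforms, ?_⟩
  -- The subtraction is truncated: if `m_j < e`, the quotient is zero and hence homogeneous of any
  -- degree.
  have hhom : ∀ j, (ℓ' j).IsHomogeneous (m j - e) := by
    intro j
    rcases le_or_gt e (m j) with hle | hlt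
    · rw [← forms_iff_isHomogeneous]
      convert! hforms j using 2
      omega
    · rw [forms_of_neg (by omega) (hforms j)]
      exact isHomogeneous_zero _ _ _
  rcases exists_common_divisor_or_X_pow_mem hhom with ⟨e', q, he', hq, hqdvd⟩ | H
  · have : e + e' ∈ D := ⟨h * q, hh.mul hq, fun j => hℓ' j ▸ mul_dvd_mul_left h (hqdvd j)⟩
    have := le_csSup hbdd this
    omega
  · exact H

end Dehomogenization

/-! ### The presentation of the symmetric algebra -/

section SymmetricAlgebra

variable {k : Type*} [Field k] {r : ℕ} {f : Fin r → MvPolynomial (Fin 2) k}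

theorem toSym_eq_evalHom (f : Fin r → MvPolynomial (Fin 2) k) :
    toSym f = evalHom (algebraMap (MvPolynomial (Fin 2) k) _)
      (fun i => SymmetricAlgebra.ι _ _ ⟨f i, Ideal.subset_span ⟨i, rfl⟩⟩) := rfl

theorem toSym_map_C (g : MvPolynomial (Fin 2) k) :
    toSym f (MvPolynomial.map C g) = algebraMap _ _ g := by
  rw [toSym_eq_evalHom, evalHom_map_C]

theorem toSym_C_X (i : Fin r) :
    toSym f (C (X i)) = SymmetricAlgebra.ι _ _ ⟨f i, Ideal.subset_span ⟨i, rfl⟩⟩ := by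
  rw [toSym_eq_evalHom, evalHom_C_X]

theorem X_pow_smul_toSym (l : Fin 2) (n : ℕ) (g : MvPolynomial (Fin 2) (MvPolynomial (Fin r) k)) :
    (X l ^ n : MvPolynomial (Fin 2) k) • toSym f g = toSym f (X l ^ n * g) := by
  rw [map_mul, Algebra.smul_def, ← toSym_map_C, map_pow, MvPolynomial.map_X]

/-- The surjection from the free module onto the ideal. -/
def toIdeal (f : Fin r → MvPolynomial (Fin 2) k) :
    (Fin r → MvPolynomial (Fin 2) k) →ₗ[MvPolynomial (Fin 2) k] Ideal.span (Set.range f) :=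
  Fintype.linearCombination _ fun i => ⟨f i, Ideal.subset_span ⟨i, rfl⟩⟩

theorem coe_toIdeal (a : Fin r → MvPolynomial (Fin 2) k) :
    (toIdeal f a : MvPolynomial (Fin 2) k) = ∑ i, a i * f i := by
  simp [toIdeal, Fintype.linearCombination_apply]

theorem toIdeal_surjective : Function.Surjective (toIdeal f) := by
  rintro ⟨g, hg⟩
  obtain ⟨a, ha⟩ := Ideal.mem_span_range_iff_exists_fun.mp hg
  exact ⟨a, Subtype.ext (by rw [coe_toIdeal, ha])⟩

theorem toSym_sum (a : Fin r → MvPolynomial (Fin 2) k) :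
    toSym f (∑ i, MvPolynomial.map C (a i) * C (X i)) =
      SymmetricAlgebra.ι _ _ (toIdeal f a) := by
  rw [toIdeal, Fintype.linearCombination_apply, map_sum, map_sum]
  refine Finset.sum_congr rfl fun i _ => ?_
  rw [map_mul, toSym_map_C, toSym_C_X, map_smul, Algebra.smul_def]

variable {μ : Fin (r - 1) → ℕ} {Φ : Matrix (Fin r) (Fin (r - 1)) (MvPolynomial (Fin 2) k)}

/-- The values of `π` on linear forms define a linear map on `R^r` that kills all syzygies. It
descends to `I`, and by the universal property of the symmetric algebra `π` factors through `toSym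
f`. -/
theorem IsSyzygyBasis.map_eq_zero_of_toSym_eq_zero (hΦ : IsSyzygyBasis f μ Φ) {E : Type*}
    [CommRing E] (π : MvPolynomial (Fin 2) (MvPolynomial (Fin r) k) →+* E)
    (hπ : ∀ j, π (symEquation Φ j) = 0) {g : MvPolynomial (Fin 2) (MvPolynomial (Fin r) k)}
    (hg : toSym f g = 0) : π g = 0 := by
  let _ : Algebra (MvPolynomial (Fin 2) k) E := (π.comp (MvPolynomial.map C)).toAlgebra
  have halg : ∀ a : MvPolynomial (Fin 2) k, algebraMap (MvPolynomial (Fin 2) k) E a =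
      π (MvPolynomial.map C a) := fun a => rfl
  let γ : (Fin r → MvPolynomial (Fin 2) k) →ₗ[MvPolynomial (Fin 2) k] E :=
    Fintype.linearCombination _ fun i => π (C (X i))
  have hγ : ∀ a, γ a = π (∑ i, MvPolynomial.map C (a i) * C (X i)) := by
    intro a
    simp only [γ, Fintype.linearCombination_apply, map_sum, Algebra.smul_def, halg, map_mul]
  have hker : LinearMap.ker (toIdeal f) ≤ LinearMap.ker γ := by
    intro a ha
    rw [LinearMap.mem_ker] at ha
    have h0 : ∑ i, a i * f i = 0 := by rw [← coe_toIdeal, ha, ZeroMemClass.coe_zero]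
    obtain ⟨w, hw⟩ := hΦ.exists_coeff h0
    have : ∑ i, MvPolynomial.map C (a i) * C (X i) =
        ∑ l, MvPolynomial.map C (w l) * symEquation Φ l := by
      simp only [hw, map_sum, map_mul, symEquation, Finset.sum_mul, Finset.mul_sum]
      rw [Finset.sum_comm]
      exact Finset.sum_congr rfl fun l _ => Finset.sum_congr rfl fun i _ => mul_assoc _ _ _
    rw [LinearMap.mem_ker, hγ, this, map_sum]
    exact Finset.sum_eq_zero fun l _ => by rw [map_mul, hπ, mul_zero]
  let φ := ((LinearMap.ker (toIdeal f)).liftQ γ hker).comp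
    ((toIdeal f).quotKerEquivOfSurjective toIdeal_surjective).symm.toLinearMap
  have hφ : ∀ a, φ (toIdeal f a) = γ a := by
    intro a
    have : ((toIdeal f).quotKerEquivOfSurjective toIdeal_surjective).symm (toIdeal f a) =
        Submodule.Quotient.mk a := by
      rw [LinearEquiv.symm_apply_eq]
      rfl
    simp only [φ, LinearMap.comp_apply, LinearEquiv.coe_coe, this, Submodule.liftQ_apply]
  have hcomp : ((SymmetricAlgebra.lift φ : _ →ₐ[MvPolynomial (Fin 2) k] _) : _ →+* _).comp
      (toSym f) = π := by
    refine ringHom_ext_map_C (fun a => ?_) fun i => ?_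
    · rw [RingHom.comp_apply, toSym_map_C]
      exact (SymmetricAlgebra.lift φ).commutes a
    · rw [RingHom.comp_apply, toSym_C_X]
      have h1 : (⟨f i, Ideal.subset_span ⟨i, rfl⟩⟩ : Ideal.span (Set.range f)) =
          toIdeal f (Pi.single i 1) := by
        ext1
        simp [coe_toIdeal, Pi.single_apply]
      refine (SymmetricAlgebra.lift_ι_apply φ _).trans ?_
      rw [h1, hφ, hγ]
      congr 1
      rw [Finset.sum_eq_single i]
      · simp
      · intro j _ hj
        simp [hj]
      · simp
  rw [← hcomp, RingHom.comp_apply, hg, map_zero]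

/-- `Sym_R(I) = A[x,y] / (L_1, …, L_{r-1})`. -/
theorem IsSyzygyBasis.toSym_eq_zero_iff (hΦ : IsSyzygyBasis f μ Φ)
    {g : MvPolynomial (Fin 2) (MvPolynomial (Fin r) k)} :
    toSym f g = 0 ↔ g ∈ Ideal.span (Set.range (symEquation Φ)) := by
  constructor
  · intro hg
    rw [← Ideal.Quotient.eq_zero_iff_mem]
    refine hΦ.map_eq_zero_of_toSym_eq_zero
      (E := MvPolynomial (Fin 2) (MvPolynomial (Fin r) k) ⧸ Ideal.span (Set.range (symEquation Φ)))
      (Ideal.Quotient.mk _) (fun j => ?_) hg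
    rw [Ideal.Quotient.eq_zero_iff_mem]
    exact Ideal.subset_span ⟨j, rfl⟩
  · intro hg
    suffices Ideal.span (Set.range (symEquation Φ)) ≤ RingHom.ker (toSym f) from this hg
    rw [Ideal.span_le]
    rintro _ ⟨l, rfl⟩
    have h0 : toIdeal f (fun i => Φ i l) = 0 := Subtype.ext (by
      rw [coe_toIdeal, hΦ.col_sum, ZeroMemClass.coe_zero])
    have := toSym_sum (f := f) (fun i => Φ i l)
    rw [h0, map_zero] at this
    exact this

end SymmetricAlgebra

/-! ### Local cohomology through the Čech complex -/

section Cech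

variable {R : Type*} [CommRing R] {x y : R} {M : Type*} [AddCommGroup M] [Module R M]

theorem mkLinearMap_eq_zero_iff {g : R} {m : M} :
    LocalizedModule.mkLinearMap (Submonoid.powers g) M m = 0 ↔ ∃ n : ℕ, g ^ n • m = 0 := by
  rw [IsLocalizedModule.eq_zero_iff (Submonoid.powers g)]
  constructor
  · rintro ⟨⟨_, n, rfl⟩, h⟩
    exact ⟨n, h⟩
  · rintro ⟨n, h⟩
    exact ⟨⟨_, n, rfl⟩, h⟩

theorem awayMap_mkLinearMap {g h : R} (hgh : g ∣ h) (m : M) :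
    awayMap M hgh (LocalizedModule.mkLinearMap (Submonoid.powers g) M m) =
      LocalizedModule.mkLinearMap (Submonoid.powers h) M m :=
  LinearMap.congr_fun (LocalizedModule.lift_comp (Submonoid.powers g)
    (LocalizedModule.mkLinearMap (Submonoid.powers h) M) (isUnit_powers_of_dvd M hgh)) m

theorem pow_smul_mk {g : R} (n : ℕ) (m : M) :
    g ^ n • LocalizedModule.mk m (⟨g ^ n, n, rfl⟩ : Submonoid.powers g) =
      LocalizedModule.mkLinearMap (Submonoid.powers g) M m := by
  rw [LocalizedModule.smul'_mk, LocalizedModule.mkLinearMap_apply]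
  exact LocalizedModule.mk_cancel (⟨g ^ n, n, rfl⟩ : Submonoid.powers g) m

theorem mk_eq_mk_pow_smul {g : R} (n N : ℕ) (m : M) :
    LocalizedModule.mk m (⟨g ^ n, n, rfl⟩ : Submonoid.powers g) =
      LocalizedModule.mk (g ^ N • m) (⟨g ^ (n + N), n + N, rfl⟩ : Submonoid.powers g) := by
  rw [LocalizedModule.mk_eq]
  refine ⟨1, ?_⟩
  simp only [Submonoid.smul_def, one_smul, smul_smul, pow_add]

variable {𝓜 : ℤ → AddSubgroup M}

/-- Sums of fractions are brought to a common denominator. Every large exponent is allowed, so that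
elements of `M_x` and `M_y` can later share one. -/
theorem exists_mk_of_mem_awayPiece {g : R} {ν : ℤ}
    (hg : ∀ (n : ℤ) (N : ℕ) (m : M), m ∈ 𝓜 n → g ^ N • m ∈ 𝓜 (n + N))
    {z : LocalizedModule (Submonoid.powers g) M} (hz : z ∈ awayPiece 𝓜 g ν) :
    ∃ n₀ : ℕ, ∀ n ≥ n₀, ∃ m ∈ 𝓜 (ν + n),
      z = LocalizedModule.mk m (⟨g ^ n, n, rfl⟩ : Submonoid.powers g) := by
  induction hz using AddSubgroup.closure_induction with
  | mem z hz =>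
    obtain ⟨n, m, hm, rfl⟩ := hz
    refine ⟨n, fun n' hn' => ?_⟩
    obtain ⟨N, rfl⟩ := Nat.exists_eq_add_of_le hn'
    refine ⟨g ^ N • m, ?_, mk_eq_mk_pow_smul n N m⟩
    have := hg _ N m hm
    rwa [add_assoc, ← Nat.cast_add] at this
  | zero => exact ⟨0, fun n _ => ⟨0, zero_mem _, (LocalizedModule.zero_mk _).symm⟩⟩
  | add a b _ _ ha hb =>
    obtain ⟨n₁, h₁⟩ := ha
    obtain ⟨n₂, h₂⟩ := hb
    refine ⟨max n₁ n₂, fun n hn => ?_⟩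
    obtain ⟨m₁, hm₁, rfl⟩ := h₁ n (le_of_max_le_left hn)
    obtain ⟨m₂, hm₂, rfl⟩ := h₂ n (le_of_max_le_right hn)
    exact ⟨m₁ + m₂, add_mem hm₁ hm₂, by
      rw [LocalizedModule.mk_add_mk, LocalizedModule.mk_eq]
      refine ⟨1, ?_⟩
      simp only [Submonoid.smul_def, one_smul, mul_smul, smul_add]⟩
  | neg a _ ha =>
    obtain ⟨n₁, h₁⟩ := ha
    refine ⟨n₁, fun n hn => ?_⟩
    obtain ⟨m₁, hm₁, rfl⟩ := h₁ n hn
    exact ⟨-m₁, neg_mem hm₁, by rw [LocalizedModule.mk_neg]⟩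

theorem subsingleton_localH0 {ν : ℤ}
    (H : ∀ m ∈ 𝓜 ν, ∀ N : ℕ, x ^ N • m = 0 → y ^ N • m = 0 → m = 0) :
    Subsingleton (localH0 x y 𝓜 ν) := by
  refine ⟨fun a b => ?_⟩
  suffices h : ∀ a : localH0 x y 𝓜 ν, a = 0 by rw [h a, h b]
  rintro ⟨m, hm, hm'⟩
  have h0 : cechD0 x y M m = 0 := hm'
  obtain ⟨a, ha⟩ := mkLinearMap_eq_zero_iff.mp (congrArg Prod.fst h0)
  obtain ⟨b, hb⟩ := mkLinearMap_eq_zero_iff.mp (congrArg Prod.snd h0)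
  refine Subtype.ext (H m hm (a + b) ?_ ?_)
  · rw [add_comm, pow_add, mul_smul, ha, smul_zero]
  · rw [pow_add, mul_smul, hb, smul_zero]

theorem subsingleton_localH1 {ν : ℤ}
    (hx : ∀ (n : ℤ) (N : ℕ) (m : M), m ∈ 𝓜 n → x ^ N • m ∈ 𝓜 (n + N))
    (hy : ∀ (n : ℤ) (N : ℕ) (m : M), m ∈ 𝓜 n → y ^ N • m ∈ 𝓜 (n + N))
    (H : ∀ N : ℕ, ∀ a ∈ 𝓜 (ν + N), ∀ b ∈ 𝓜 (ν + N), y ^ N • a = x ^ N • b →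
      ∃ m ∈ 𝓜 ν, a = x ^ N • m ∧ b = y ^ N • m) :
    Subsingleton (LocalH1 x y 𝓜 ν) := by
  suffices h : (cechB1 x y 𝓜 ν).addSubgroupOf (cechZ1 x y 𝓜 ν) = ⊤ by
    rw [LocalH1, h]
    exact QuotientAddGroup.subsingleton_quotient_top
  rw [AddSubgroup.addSubgroupOf_eq_top]
  rintro ⟨z₁, z₂⟩ ⟨⟨hz₁, hz₂⟩, hz⟩
  have hz : cechD1 x y M (z₁, z₂) = 0 := hz
  obtain ⟨n₁, h₁⟩ := exists_mk_of_mem_awayPiece hx hz₁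
  obtain ⟨n₂, h₂⟩ := exists_mk_of_mem_awayPiece hy hz₂
  set n := max n₁ n₂
  obtain ⟨a, ha, haz⟩ := h₁ n (le_max_left _ _)
  obtain ⟨b, hb, hbz⟩ := h₂ n (le_max_right _ _)
  dsimp only at haz hbz
  simp only [cechD1, LinearMap.sub_apply, LinearMap.comp_apply, LinearMap.snd_apply,
    LinearMap.fst_apply, sub_eq_zero] at hz
  have hι : LocalizedModule.mkLinearMap (Submonoid.powers (x * y)) M
      (x ^ n • b - y ^ n • a) = 0 := by
    rw [map_sub, map_smul, map_smul, ← awayMap_mkLinearMap (Dvd.intro_left x rfl),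
      ← awayMap_mkLinearMap (Dvd.intro y rfl), ← pow_smul_mk n a, ← pow_smul_mk n b, ← haz, ← hbz,
      map_smul, map_smul, hz, smul_comm, sub_self]
  obtain ⟨N, hN⟩ := mkLinearMap_eq_zero_iff.mp hι
  -- The cocycle condition for the numerators holds only after multiplication by `(xy) ^ N`;
  -- replacing `a`, `b` by `x ^ N a`, `y ^ N b` and `n` by `n + N` absorbs this factor.
  obtain ⟨m, hm, hma, hmb⟩ := H (n + N) (x ^ N • a)
    (by have := hx _ N a ha; rwa [add_assoc, ← Nat.cast_add] at this) (y ^ N • b)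
    (by have := hy _ N b hb; rwa [add_assoc, ← Nat.cast_add] at this) (by
      rw [smul_sub, sub_eq_zero, mul_pow] at hN
      rw [smul_smul, smul_smul, pow_add, pow_add]
      rw [smul_smul, smul_smul] at hN
      rw [show x ^ n * x ^ N * y ^ N = x ^ N * y ^ N * x ^ n by ring, hN]
      congr 1
      ring)
  refine ⟨m, hm, ?_⟩
  have hfrac : ∀ (g : R) (c : M), g ^ N • c = g ^ (n + N) • m →
      LocalizedModule.mkLinearMap (Submonoid.powers g) M m =
        LocalizedModule.mk c (⟨g ^ n, n, rfl⟩ : Submonoid.powers g) := by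
    intro g c hc
    rw [mk_eq_mk_pow_smul n N c, hc, LocalizedModule.mkLinearMap_apply]
    exact (LocalizedModule.mk_cancel (⟨g ^ (n + N), n + N, rfl⟩ : Submonoid.powers g) m).symm
  exact Prod.ext ((hfrac x a hma).trans haz.symm) ((hfrac y b hmb).trans hbz.symm)

end Cech

/-! ### Vanishing of the local cohomology of the symmetric algebra -/

section Vanishing

variable {k : Type*} [Field k] {r : ℕ} {f : Fin r → MvPolynomial (Fin 2) k}
  {μ : Fin (r - 1) → ℕ} {Φ : Matrix (Fin r) (Fin (r - 1)) (MvPolynomial (Fin 2) k)}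

/-- The Koszul syzygy `f_i e_{i'} - f_{i'} e_i`, with entries of degree `d`, is a multiple of the
only column. -/
theorem IsSyzygyBasis.degree_le_of_subsingleton {d : ℕ} [Nontrivial (Fin r)]
    [Subsingleton (Fin (r - 1))] (hΦ : IsSyzygyBasis f μ Φ) (hf : ∀ i, (f i).IsHomogeneous d)
    (h0 : ∃ i, f i ≠ 0) (j : Fin (r - 1)) : μ j ≤ d := by
  obtain ⟨i, hi⟩ := h0
  obtain ⟨i', hi'⟩ := exists_ne i
  obtain ⟨w, hw⟩ := hΦ.exists_coeff (a := Pi.single i' (f i) - Pi.single i (f i')) (by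
    simp_rw [Pi.sub_apply, sub_mul, Finset.sum_sub_distrib, Pi.single_apply]
    simp [mul_comm])
  have h := hw i'
  rw [Pi.sub_apply, Pi.single_eq_same, Pi.single_eq_of_ne hi', sub_zero,
    Finset.sum_eq_single j (fun l _ hl => absurd (Subsingleton.elim l j) hl)
      (fun h => absurd (Finset.mem_univ j) h)] at h
  rw [h] at hi
  have hne := mul_ne_zero_iff.mp hi
  have hdeg := totalDegree_mul_of_isDomain hne.1 hne.2
  rw [← h, (hf i).totalDegree (h ▸ hi), (hΦ.homogeneous i' j).totalDegree hne.2] at hdeg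
  omega

/-- With at least two columns, `μ_j ≤ μ_l + μ_j` for some `l ≠ j`; with one column, `μ_j ≤ d`. -/
theorem IsSyzygyBasis.degree_le {d : ℕ} (hΦ : IsSyzygyBasis f μ Φ)
    (hf : ∀ i, (f i).IsHomogeneous d) (h0 : ∃ i, f i ≠ 0) {ν : ℤ}
    (hν : ∀ i j, i ≠ j → (μ i + μ j : ℤ) ≤ ν) (hν2 : r = 2 → (d : ℤ) ≤ ν) (j : Fin (r - 1)) :
    (μ j : ℤ) ≤ ν := by
  by_cases h2 : r = 2
  · have : Nontrivial (Fin r) := Fin.nontrivial_iff_two_le.mpr h2.ge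
    have : Subsingleton (Fin (r - 1)) := Fin.subsingleton_iff_le_one.mpr (by omega)
    have := hΦ.degree_le_of_subsingleton hf h0 j
    have := hν2 h2
    omega
  · have : Nontrivial (Fin (r - 1)) := Fin.nontrivial_iff_two_le.mpr (by have := j.2; omega)
    obtain ⟨l, hl⟩ := exists_ne j
    have := hν l j hl
    omega

theorem X_pow_smul_mem_symPiece (l : Fin 2) (n : ℤ) (N : ℕ)
    (m : SymmetricAlgebra (MvPolynomial (Fin 2) k) (Ideal.span (Set.range f)))
    (hm : m ∈ symPiece f n) : (X l ^ N : MvPolynomial (Fin 2) k) • m ∈ symPiece f (n + N) := by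
  obtain ⟨g, hg, rfl⟩ := hm
  refine ⟨X l ^ N * g, X_pow_mul_mem_forms l N hg rfl, ?_⟩
  exact (X_pow_smul_toSym l N g).symm

theorem IsSyzygyBasis.subsingleton_localH0 (hΦ : IsSyzygyBasis f μ Φ) {M : ℕ}
    (hM : X 0 ^ M ∈ Ideal.span (Set.range f)) {ν : ℤ}
    (hν : ∀ i j, i ≠ j → (μ i + μ j : ℤ) ≤ ν) :
    Subsingleton (localH0 (X 0 : MvPolynomial (Fin 2) k) (X 1) (symPiece f) ν) := by
  refine CurveFibers.subsingleton_localH0 fun m hm N hx hy => ?_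
  obtain ⟨g, hg, rfl⟩ := hm
  change (X 0 ^ N : MvPolynomial (Fin 2) k) • toSym f g = 0 at hx
  change (X 1 ^ N : MvPolynomial (Fin 2) k) • toSym f g = 0 at hy
  change toSym f g = 0
  rw [X_pow_smul_toSym, hΦ.toSym_eq_zero_iff] at hx hy
  rw [hΦ.toSym_eq_zero_iff]
  exact mem_span_of_X_pow_mul_mem (symEquation_mem hΦ.homogeneous)
    (fun j l hjl => by have := hν j l hjl; omega) (fun c hc => hΦ.exists_isKoszul hM hc) hg hx hy

theorem IsSyzygyBasis.subsingleton_localH1 (hΦ : IsSyzygyBasis f μ Φ) {ν : ℤ}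
    (hν : ∀ j, (μ j : ℤ) ≤ ν) :
    Subsingleton (LocalH1 (X 0 : MvPolynomial (Fin 2) k) (X 1) (symPiece f) ν) := by
  refine CurveFibers.subsingleton_localH1 (X_pow_smul_mem_symPiece 0)
    (X_pow_smul_mem_symPiece 1) fun N a ha b hb hab => ?_
  obtain ⟨a, ha, rfl⟩ := ha
  obtain ⟨b, hb, rfl⟩ := hb
  change (X 1 ^ N : MvPolynomial (Fin 2) k) • toSym f a =
    (X 0 ^ N : MvPolynomial (Fin 2) k) • toSym f b at hab
  rw [X_pow_smul_toSym, X_pow_smul_toSym, ← sub_eq_zero, ← map_sub, hΦ.toSym_eq_zero_iff] at hab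
  obtain ⟨g, hg, h0, h1⟩ := exists_forms_of_cocycle (symEquation_mem hΦ.homogeneous)
    (fun j => by have := hν j; omega) ha hb hab
  refine ⟨toSym f g, ⟨g, hg, rfl⟩, ?_, ?_⟩
  · rw [X_pow_smul_toSym]
    rw [← hΦ.toSym_eq_zero_iff, map_sub, sub_eq_zero] at h0
    exact h0
  · rw [X_pow_smul_toSym]
    rw [← hΦ.toSym_eq_zero_iff, map_sub, sub_eq_zero] at h1
    exact h1

end Vanishing

/-! ### The coordinate ring of a fiber -/

section DvdForms

variable {K : Type*} [Field K]

/-- The forms of degree `n` which are divisible by `h`. -/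
def dvdForms (h : MvPolynomial (Fin 2) K) (n : ℤ) : Submodule K (forms K n) :=
  ((Ideal.span {h}).restrictScalars K).comap (forms K n).subtype

theorem mem_dvdForms {h : MvPolynomial (Fin 2) K} {n : ℤ} {a : forms K n} :
    a ∈ dvdForms h n ↔ h ∣ a := by
  rw [dvdForms, Submodule.mem_comap, Submodule.restrictScalars_mem, Ideal.mem_span_singleton]
  rfl

instance (n : ℤ) : Module.Finite K (forms K n) := by
  obtain ⟨m, rfl⟩ | h : (∃ m : ℕ, n = m) ∨ n < 0 := by
    rcases lt_or_ge n 0 with h | h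
    · exact Or.inr h
    · exact Or.inl ⟨n.toNat, by omega⟩
  · exact Module.Finite.of_basis (formsBasis K m)
  · have : Subsingleton (forms K n) :=
      ⟨fun a b => Subtype.ext ((forms_of_neg h a.2).trans (forms_of_neg h b.2).symm)⟩
    infer_instance

/-- Multiplication by `h` identifies the forms of degree `n - e` with these multiples. -/
theorem finrank_dvdForms {h : MvPolynomial (Fin 2) K} {e n : ℕ} (hh : h.IsHomogeneous e)
    (h0 : h ≠ 0) (hen : e ≤ n) : Module.finrank K (dvdForms h n) + e = n + 1 := by
  have hh' := forms_iff_isHomogeneous.mpr hh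
  let T : forms K ((n - e : ℕ) : ℤ) →ₗ[K] forms K (n : ℤ) :=
    ((LinearMap.mulRight K h).comp (Submodule.subtype _)).codRestrict _ (fun a => by
      convert! mul_mem_forms a.2 hh' using 2
      omega)
  have hT : ∀ a, (T a : MvPolynomial (Fin 2) K) = a * h := fun a => rfl
  have hinj : Function.Injective T := fun a b hab => by
    have := congrArg Subtype.val hab
    rw [hT, hT] at this
    exact Subtype.ext (mul_right_cancel₀ h0 this)
  have hrange : LinearMap.range T = dvdForms h n := by
    ext a
    rw [mem_dvdForms]
    constructor
    · rintro ⟨b, rfl⟩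
      exact ⟨b, by rw [hT, mul_comm]⟩
    · rintro ⟨c, hc⟩
      refine ⟨⟨c, mem_forms_of_mul_mem hh' h0 ?_⟩, Subtype.ext ?_⟩
      · rw [mul_comm, ← hc]
        convert! a.2 using 2
        omega
      · exact (hT _).trans ((mul_comm _ _).trans hc.symm)
  rw [← hrange, LinearMap.finrank_range_of_inj hinj, finrank_forms]
  omega

end DvdForms

/-! ### Homogeneous fractions with denominator a power of `F_i`. -/

section Fiber

attribute [local instance] MvPolynomial.gradedAlgebra

variable {K : Type*} [Field K] {r d : ℕ} {F : Fin r → MvPolynomial (Fin 2) K}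

/-- The fraction `a / F_i ^ n`. -/
def awayFrac (hF : ∀ i, (F i).IsHomogeneous d) (i : Fin r) (n : ℕ)
    (a : forms K ((n * d : ℕ) : ℤ)) :
    HomogeneousLocalization.Away (homogeneousSubmodule (Fin 2) K) (F i) :=
  HomogeneousLocalization.Away.mk (homogeneousSubmodule (Fin 2) K) (hF i) n a
    (forms_iff_isHomogeneous.mp a.2)

theorem pow_mul_mem_forms (hF : ∀ i, (F i).IsHomogeneous d) (i : Fin r) {n : ℕ} (m : ℕ) {t : ℕ}
    (h : n + m = t) {a : MvPolynomial (Fin 2) K}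
    (ha : a ∈ forms K ((n * d : ℕ) : ℤ)) : F i ^ m * a ∈ forms K ((t * d : ℕ) : ℤ) := by
  rw [forms_iff_isHomogeneous] at *
  have := ((hF i).pow m).mul ha
  rwa [show d * m + n * d = t * d by rw [← h]; ring] at this

theorem minor_mem_forms (hF : ∀ i, (F i).IsHomogeneous d) (i : Fin r) (p : Fin r → K)
    (j : Fin r) : p i • F j - p j • F i ∈ forms K ((1 * d : ℕ) : ℤ) := by
  rw [one_mul]
  exact sub_mem (Submodule.smul_mem _ _ (forms_iff_isHomogeneous.mpr (hF j)))
    (Submodule.smul_mem _ _ (forms_iff_isHomogeneous.mpr (hF i)))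

variable (hF : ∀ i, (F i).IsHomogeneous d) (i : Fin r)

theorem awayFrac_val (n : ℕ) (a : forms K ((n * d : ℕ) : ℤ)) :
    (awayFrac hF i n a).val =
      Localization.mk (a : MvPolynomial (Fin 2) K) (⟨F i ^ n, n, rfl⟩ : Submonoid.powers (F i)) :=
  rfl

theorem awayFrac_surjective
    (z : HomogeneousLocalization.Away (homogeneousSubmodule (Fin 2) K) (F i)) :
    ∃ n a, z = awayFrac hF i n a := by
  obtain ⟨n, a, ha, rfl⟩ := HomogeneousLocalization.Away.mk_surjective _ (hF i) z
  exact ⟨n, ⟨a, forms_iff_isHomogeneous.mpr ha⟩, rfl⟩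

theorem awayFrac_eq_iff {n m : ℕ} {a : forms K ((n * d : ℕ) : ℤ)} {b : forms K ((m * d : ℕ) : ℤ)} :
    awayFrac hF i n a = awayFrac hF i m b ↔
      ∃ c : ℕ, F i ^ c * (F i ^ m * a) = F i ^ c * (F i ^ n * b) := by
  rw [← HomogeneousLocalization.val_injective (Submonoid.powers (F i)) |>.eq_iff, awayFrac_val,
    awayFrac_val, Localization.mk_eq_mk_iff, Localization.r_iff_exists]
  constructor
  · rintro ⟨⟨_, c, rfl⟩, hc⟩
    exact ⟨c, hc⟩
  · rintro ⟨c, hc⟩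
    exact ⟨⟨_, c, rfl⟩, hc⟩

theorem awayFrac_add (n : ℕ) (a b : forms K ((n * d : ℕ) : ℤ)) :
    awayFrac hF i n (a + b) = awayFrac hF i n a + awayFrac hF i n b := by
  refine HomogeneousLocalization.val_injective _ ?_
  rw [HomogeneousLocalization.val_add, awayFrac_val, awayFrac_val, awayFrac_val,
    Localization.add_mk_self, Submodule.coe_add]

theorem awayFrac_zero (n : ℕ) : awayFrac hF i n 0 = 0 := by
  simpa using awayFrac_add hF i n 0 0

theorem awayFrac_mul {n m t : ℕ} (h : n + m = t) (a : forms K ((n * d : ℕ) : ℤ))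
    (b : forms K ((m * d : ℕ) : ℤ)) (c : forms K ((t * d : ℕ) : ℤ))
    (hc : (c : MvPolynomial (Fin 2) K) = a * b) :
    awayFrac hF i n a * awayFrac hF i m b = awayFrac hF i t c := by
  subst h
  refine HomogeneousLocalization.val_injective _ ?_
  rw [HomogeneousLocalization.val_mul, awayFrac_val, awayFrac_val, awayFrac_val,
    Localization.mk_mul, hc]
  congr 1
  exact Subtype.ext (pow_add _ _ _).symm

theorem awayFrac_pow_mul {n m t : ℕ} (h : n + m = t) (a : forms K ((n * d : ℕ) : ℤ)) :
    awayFrac hF i t ⟨F i ^ m * a, pow_mul_mem_forms hF i m h a.2⟩ = awayFrac hF i n a := by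
  rw [awayFrac_eq_iff]
  refine ⟨0, ?_⟩
  subst h
  ring

variable (p : Fin r → K)

/-- The linear map `a ↦ a / F_i ^ n` into the coordinate ring of the fiber. -/
def fiberFrac (n : ℕ) : forms K ((n * d : ℕ) : ℤ) →ₗ[K] FiberRing F hF p i where
  toFun a := Ideal.Quotient.mk (fiberIdeal F hF p i) (awayFrac hF i n a)
  map_add' a b := by rw [awayFrac_add, map_add]; rfl
  map_smul' c a := by
    refine Eq.trans ?_ (Algebra.smul_def (A := FiberRing F hF p i) c
      (Ideal.Quotient.mk (fiberIdeal F hF p i) (awayFrac hF i n a))).symm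
    change Ideal.Quotient.mk (fiberIdeal F hF p i) _ = Ideal.Quotient.mk (fiberIdeal F hF p i) _ *
      Ideal.Quotient.mk (fiberIdeal F hF p i) _
    rw [← map_mul]
    congr 1
    refine HomogeneousLocalization.val_injective _ ?_
    rw [HomogeneousLocalization.val_mul, awayFrac_val, awayFrac_val]
    change _ = Localization.mk (C c) 1 * _
    rw [Localization.mk_mul, one_mul, Submodule.coe_smul, smul_eq_C_mul]

theorem fiberFrac_eq_zero_iff {n : ℕ} {a : forms K ((n * d : ℕ) : ℤ)} :
    fiberFrac hF i p n a = 0 ↔ awayFrac hF i n a ∈ fiberIdeal F hF p i :=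
  Ideal.Quotient.eq_zero_iff_mem

theorem fiberFrac_pow_mul {n m t : ℕ} (h : n + m = t) (a : forms K ((n * d : ℕ) : ℤ)) :
    fiberFrac hF i p t ⟨F i ^ m * a, pow_mul_mem_forms hF i m h a.2⟩ = fiberFrac hF i p n a :=
  congrArg (Ideal.Quotient.mk (fiberIdeal F hF p i)) (awayFrac_pow_mul hF i h a)

theorem fiberFrac_exists (z : FiberRing F hF p i) : ∃ n a, z = fiberFrac hF i p n a := by
  obtain ⟨z, rfl⟩ := Ideal.Quotient.mk_surjective z
  obtain ⟨n, a, rfl⟩ := awayFrac_surjective hF i z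
  exact ⟨n, a, rfl⟩

/-- Write `a / F_i ^ n = F_i a / F_i ^ (n + 1)` and expand `F_i a` in the minors with coefficients
`c_j` of degree `nd`: each term is `c_j / F_i ^ n` times a generator of the fiber ideal. -/
theorem fiberFrac_eq_zero_of_mul_mem {n : ℕ} {a : forms K ((n * d : ℕ) : ℤ)}
    (ha : F i * a ∈ Ideal.span (Set.range fun j => p i • F j - p j • F i)) :
    fiberFrac hF i p n a = 0 := by
  rw [fiberFrac_eq_zero_iff, ← awayFrac_pow_mul hF i (m := 1) rfl]
  obtain ⟨c, hc, hsum⟩ := exists_forms_coeff (fun j => minor_mem_forms hF i p j)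
    (pow_mul_mem_forms hF i 1 rfl a.2) (by rwa [pow_one])
  have hc' : ∀ j, c j ∈ forms K ((n * d : ℕ) : ℤ) := fun j => by
    convert! hc j using 2
    push_cast
    ring
  have hmem : ∀ j, c j * (p i • F j - p j • F i) ∈ forms K (((n + 1) * d : ℕ) : ℤ) := fun j => by
    convert! mul_mem_forms (hc' j) (minor_mem_forms hF i p j) using 2
    push_cast
    ring
  have key : ∀ s : Finset (Fin r), ∀ b : forms K (((n + 1) * d : ℕ) : ℤ),
      (b : MvPolynomial (Fin 2) K) = ∑ j ∈ s, c j * (p i • F j - p j • F i) →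
      awayFrac hF i (n + 1) b ∈ fiberIdeal F hF p i := by
    classical
    intro s
    induction s using Finset.induction_on with
    | empty =>
      intro b hb
      have hb0 : b = 0 := Subtype.ext hb
      rw [hb0, awayFrac_zero]
      exact zero_mem _
    | insert j s hj ih =>
      intro b hb
      rw [Finset.sum_insert hj] at hb
      have hs : ∑ j ∈ s, c j * (p i • F j - p j • F i) ∈ forms K (((n + 1) * d : ℕ) : ℤ) :=
        Submodule.sum_mem _ fun j _ => hmem j
      rw [Subtype.ext (a1 := b) (a2 := ⟨_, hmem j⟩ + ⟨_, hs⟩) hb, awayFrac_add]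
      refine add_mem ?_ (ih _ rfl)
      rw [← awayFrac_mul hF i rfl ⟨c j, hc' j⟩ ⟨_, minor_mem_forms hF i p j⟩ ⟨_, hmem j⟩ rfl]
      exact Ideal.mul_mem_left _ _ (Ideal.subset_span ⟨j, rfl⟩)
  exact key Finset.univ _ hsum

end Fiber

/-! ### The dimension of the coordinate ring of a fiber. -/

section FiberDegree

attribute [local instance] MvPolynomial.gradedAlgebra

variable {K : Type*} [Field K] {r d : ℕ} {F : Fin r → MvPolynomial (Fin 2) K}
  {h : MvPolynomial (Fin 2) K}

/-- Modulo `h` one has `F_j = (p_j / p_i) F_i`, so any combination of the `F_j` becomes a multiple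
of `F_i`. -/
theorem exists_X_pow_sub_dvd (hF : ∀ i, (F i).IsHomogeneous d) (i : Fin r) (p : Fin r → K)
    (hG : ∀ j, h ∣ p i • F j - p j • F i) (hp : p i ≠ 0) {N : ℕ}
    (hN : ∀ l, X l ^ N ∈ Ideal.span (Set.range F))
    (l : Fin 2) :
    ∃ c ∈ forms K ((N : ℤ) - d), h ∣ X l ^ N - c * F i := by
  obtain ⟨s, hs, hsum⟩ := exists_forms_coeff (fun j => forms_iff_isHomogeneous.mpr (hF j))
    (X_pow_mem_forms l N) (hN l)
  refine ⟨∑ j, ((p i)⁻¹ * p j) • s j, Submodule.sum_mem _ fun j _ => Submodule.smul_mem _ _ (hs j),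
    ?_⟩
  rw [hsum, Finset.sum_mul, ← Finset.sum_sub_distrib]
  refine Finset.dvd_sum fun j _ => ?_
  have : s j * F j - ((p i)⁻¹ * p j) • s j * F i =
      (C (p i)⁻¹ * s j) * (p i • F j - p j • F i) := by
    have h1 : (C (p i)⁻¹ * C (p i) : MvPolynomial (Fin 2) K) = 1 := by
      rw [← C_mul, inv_mul_cancel₀ hp, C_1]
    simp only [smul_eq_C_mul, C_mul]
    linear_combination (-s j * F j) * h1
  rw [this]
  exact Dvd.dvd.mul_left (hG j) _

/-- Modulo `h`, both `x ^ N` and `y ^ N` are multiples of `F_i`, so a factor `F_i` can be traded for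
them, and these cancel by `dvd_of_X_pow_mul_dvd`. -/
theorem dvd_of_dvd_pow_mul (hF : ∀ i, (F i).IsHomogeneous d) (i : Fin r) (p : Fin r → K)
    (hG : ∀ j, h ∣ p i • F j - p j • F i) (hp : p i ≠ 0) {N : ℕ}
    (hN : ∀ l, X l ^ N ∈ Ideal.span (Set.range F))
    {c : ℕ} {a : MvPolynomial (Fin 2) K} (ha : h ∣ F i ^ c * a) :
    h ∣ a := by
  induction c with
  | zero => simpa using ha
  | succ c ih =>
    refine ih ?_
    have hX : ∀ l, h ∣ X l ^ N * (F i ^ c * a) := by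
      intro l
      obtain ⟨c', -, hc'⟩ := exists_X_pow_sub_dvd hF i p hG hp hN l
      have := dvd_add (Dvd.dvd.mul_right hc' (F i ^ c * a)) (Dvd.dvd.mul_left ha c')
      convert! this using 1
      ring
    obtain ⟨u, hu⟩ := hX 0
    obtain ⟨v, hv⟩ := hX 1
    exact dvd_of_X_pow_mul_dvd hu.symm hv.symm

/-- Every element of the fiber ideal has some representation with numerator divisible by `h`;
changing the representation costs only powers of `F_i`, which cancel modulo `h`. -/
theorem dvd_of_fiberFrac_eq_zero (hF : ∀ i, (F i).IsHomogeneous d) (i : Fin r) (p : Fin r → K)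
    (hG : ∀ j, h ∣ p i • F j - p j • F i) (hp : p i ≠ 0) {N : ℕ}
    (hN : ∀ l, X l ^ N ∈ Ideal.span (Set.range F))
    {n : ℕ} {a : forms K ((n * d : ℕ) : ℤ)}
    (ha : fiberFrac hF i p n a = 0) : h ∣ a := by
  rw [fiberFrac_eq_zero_iff] at ha
  suffices H : ∀ z ∈ fiberIdeal F hF p i, ∃ n, ∃ a : forms K ((n * d : ℕ) : ℤ),
      z = awayFrac hF i n a ∧ h ∣ a by
    obtain ⟨m, b, hab, hb⟩ := H _ ha
    obtain ⟨c, hc⟩ := (awayFrac_eq_iff hF i).mp hab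
    rw [← mul_assoc, ← pow_add] at hc
    refine dvd_of_dvd_pow_mul hF i p hG hp hN (c := c + m) ?_
    rw [hc]
    exact Dvd.dvd.mul_left (Dvd.dvd.mul_left hb _) _
  intro z hz
  induction hz using Submodule.span_induction with
  | mem z hz =>
    obtain ⟨j, rfl⟩ := hz
    exact ⟨1, ⟨_, minor_mem_forms hF i p j⟩, rfl, hG j⟩
  | zero => exact ⟨0, 0, (awayFrac_zero hF i 0).symm, dvd_zero _⟩
  | add z w _ _ hz hw =>
    obtain ⟨n, a, rfl, ha⟩ := hz
    obtain ⟨m, b, rfl, hb⟩ := hw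
    refine ⟨n + m, ⟨_, pow_mul_mem_forms hF i m rfl a.2⟩ +
      ⟨_, pow_mul_mem_forms hF i n (add_comm m n) b.2⟩, ?_, ?_⟩
    · rw [awayFrac_add, awayFrac_pow_mul hF i rfl a, awayFrac_pow_mul hF i (add_comm m n) b]
    · exact dvd_add (Dvd.dvd.mul_left ha _) (Dvd.dvd.mul_left hb _)
  | smul w z _ hz =>
    obtain ⟨n, a, rfl, ha⟩ := hz
    obtain ⟨m, b, rfl⟩ := awayFrac_surjective hF i w
    have hmem : (b * a : MvPolynomial (Fin 2) K) ∈ forms K (((m + n) * d : ℕ) : ℤ) := by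
      convert! mul_mem_forms b.2 a.2 using 2
      push_cast
      ring
    exact ⟨m + n, ⟨_, hmem⟩, awayFrac_mul hF i rfl b a _ rfl, Dvd.dvd.mul_left ha _⟩

/-- In degrees at least `2N` a form is `y ^ N b₁ - x ^ N b₂`. Modulo `h` the powers of `x` and `y`
are multiples of `F_i`, so one factor `F_i` splits off; this is repeated `m` times. -/
theorem exists_pow_mul_sub_dvd (hF : ∀ i, (F i).IsHomogeneous d) (i : Fin r) (p : Fin r → K)
    (hG : ∀ j, h ∣ p i • F j - p j • F i) (hp : p i ≠ 0) {N : ℕ}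
    (hN : ∀ l, X l ^ N ∈ Ideal.span (Set.range F))
    {n : ℕ} (hn : 2 * N ≤ n * d) (m : ℕ) {b : MvPolynomial (Fin 2) K}
    (hb : b ∈ forms K (((n + m) * d : ℕ) : ℤ)) :
    ∃ a ∈ forms K ((n * d : ℕ) : ℤ), h ∣ F i ^ m * a - b := by
  induction m generalizing b with
  | zero => exact ⟨b, hb, by simp⟩
  | succ m ih =>
    obtain ⟨c₀, hc₀, hd₀⟩ := exists_X_pow_sub_dvd hF i p hG hp hN 0
    obtain ⟨c₁, hc₁, hd₁⟩ := exists_X_pow_sub_dvd hF i p hG hp hN 1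
    have hle : n * d ≤ (n + (m + 1)) * d := Nat.mul_le_mul_right d (Nat.le_add_right _ _)
    obtain ⟨b₁, b₂, hb₁, hb₂, rfl⟩ := exists_split (N := N) (by omega) hb
    have hdeg : (N : ℤ) - d + (((n + (m + 1)) * d : ℕ) - N) = ((n + m) * d : ℕ) := by
      push_cast
      ring
    obtain ⟨a, ha, hda⟩ := ih (b := c₁ * b₁ - c₀ * b₂)
      (sub_mem (hdeg ▸ mul_mem_forms hc₁ hb₁) (hdeg ▸ mul_mem_forms hc₀ hb₂))
    refine ⟨a, ha, ?_⟩
    have := dvd_sub (dvd_add (Dvd.dvd.mul_left hda (F i)) (Dvd.dvd.mul_right hd₀ b₂))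
      (Dvd.dvd.mul_right hd₁ b₁)
    convert! this using 1
    ring

/-- The degree of the fiber is the degree of the greatest common divisor of its equations. -/
theorem finrank_fiberRing (hF : ∀ i, (F i).IsHomogeneous d) (i : Fin r) (p : Fin r → K)
    (hG : ∀ j, h ∣ p i • F j - p j • F i) (hp : p i ≠ 0) {N : ℕ}
    (hN : ∀ l, X l ^ N ∈ Ideal.span (Set.range F))
    (hd : 1 ≤ d) {e : ℕ} (hh : h.IsHomogeneous e) (h0 : h ≠ 0) {B : ℕ}
    (hB : ∀ n ≥ B, ∀ a ∈ forms K (n : ℤ), h ∣ a →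
      F i * a ∈ Ideal.span (Set.range fun j => p i • F j - p j • F i)) :
    Module.Finite K (FiberRing F hF p i) ∧ Module.finrank K (FiberRing F hF p i) = e := by
  -- The summands serve, in turn, the surjectivity of `fiberFrac`, the dimension count for multiples
  -- of `h`, and the bound in `hB`.
  set n := 2 * N + e + B
  have hnd : n ≤ n * d := Nat.le_mul_of_pos_right n hd
  have hsurj : Function.Surjective (fiberFrac hF i p n) := by
    intro z
    obtain ⟨m, b, rfl⟩ := fiberFrac_exists hF i p z
    have hb' := pow_mul_mem_forms hF i n (add_comm m n) b.2
    obtain ⟨a, ha, hdvd⟩ := exists_pow_mul_sub_dvd hF i p hG hp hN (n := n) (by omega) m hb'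
    refine ⟨⟨a, ha⟩, ?_⟩
    rw [← fiberFrac_pow_mul hF i p (add_comm m n) b,
      ← fiberFrac_pow_mul hF i p (m := m) rfl ⟨a, ha⟩, ← sub_eq_zero, ← map_sub]
    refine fiberFrac_eq_zero_of_mul_mem hF i p (hB _ ?_ _ (Subtype.prop _) hdvd)
    have : n * d ≤ (n + m) * d := Nat.mul_le_mul_right d (Nat.le_add_right _ _)
    omega
  have hker : LinearMap.ker (fiberFrac hF i p n) = dvdForms h ((n * d : ℕ) : ℤ) := by
    ext a
    rw [LinearMap.mem_ker, mem_dvdForms]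
    exact ⟨dvd_of_fiberFrac_eq_zero hF i p hG hp hN, fun ha =>
      fiberFrac_eq_zero_of_mul_mem hF i p (hB _ (by omega) _ a.2 ha)⟩
  refine ⟨Module.Finite.of_surjective _ hsurj, ?_⟩
  have h1 := LinearMap.finrank_range_add_finrank_ker (fiberFrac hF i p n)
  rw [LinearMap.range_eq_top.mpr hsurj, finrank_top, hker, finrank_forms] at h1
  have h2 := finrank_dvdForms (n := n * d) hh h0 (by omega)
  omega

end FiberDegree

/-! ### Specialization of the multiplication matrices -/

section Specialization

variable {A K : Type*} [CommRing A] [Field K] (φ : A →+* K)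

/-- Specialization of the coefficients of forms. -/
def evForms (n : ℤ) : forms A n →ₛₗ[φ] forms K n where
  toFun g := ⟨MvPolynomial.map φ g, mem_forms.mpr fun m hm =>
    mem_forms.mp g.2 m (support_map_subset _ _ hm)⟩
  map_add' g h := Subtype.ext (map_add _ _ _)
  map_smul' c g := Subtype.ext (by
    simp [smul_eq_C_mul])

@[simp]
theorem coe_evForms (n : ℤ) (g : forms A n) :
    (evForms φ n g : MvPolynomial (Fin 2) K) = MvPolynomial.map φ g := rfl

/-- Monomials are specializations of monomials. The span is needed, since `φ` may fail to be
surjective. -/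
theorem span_range_evForms (n : ℤ) : Submodule.span K (Set.range (evForms φ n)) = ⊤ := by
  rw [eq_top_iff]
  have h : forms K n ≤ (Submodule.span K (Set.range (evForms φ n))).map (forms K n).subtype := by
    refine (show forms K n = Submodule.span K ((monomial · 1) '' {m | (m.degree : ℤ) = n}) from
      restrictSupport_eq_span _ _).trans_le (Submodule.span_le.mpr ?_)
    rintro _ ⟨m, hm, rfl⟩
    exact ⟨_, Submodule.subset_span ⟨⟨monomial m 1, monomial_mem_forms m 1 hm⟩, rfl⟩, by simp⟩
  rintro a -
  obtain ⟨b, hb, hab⟩ := h a.2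
  rwa [← Subtype.ext (a1 := b) (a2 := a) hab]

variable [Nontrivial A] {m n : Type*} [Fintype m] [Fintype n] [DecidableEq n]
  {N : Type*} [AddCommGroup N] [Module A N] {d : ℕ}
  (b : Module.Basis n A N) (b' : Module.Basis m A (forms A (d : ℤ)))

theorem card_basis_forms {A : Type*} [CommRing A] [Nontrivial A] {m : Type*} [Fintype m] {d : ℕ}
    (b' : Module.Basis m A (forms A (d : ℤ))) : Fintype.card m = d + 1 := by
  rw [← Module.finrank_eq_card_basis b', finrank_forms]

/-- The specialized basis `b'` spans the forms over `K`; as the dimensions agree, it gives an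
isomorphism `τ` that takes the columns of the specialized matrix to the specialized values of `T`.
-/
theorem rank_toMatrix_map (T : N →ₗ[A] forms A (d : ℤ)) :
    ((LinearMap.toMatrix b b' T).map φ).rank =
      Module.finrank K (Submodule.span K (Set.range fun j => evForms φ d (T (b j)))) := by
  let τ : (m → K) →ₗ[K] forms K (d : ℤ) := Fintype.linearCombination K fun i => evForms φ d (b' i)
  have hsurj : LinearMap.range τ = ⊤ := by
    rw [eq_top_iff, ← span_range_evForms φ d, Submodule.span_le]
    rintro _ ⟨g, rfl⟩
    refine ⟨fun i => φ (b'.repr g i), ?_⟩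
    conv_rhs => rw [← b'.sum_repr g]
    rw [map_sum, Fintype.linearCombination_apply]
    exact Finset.sum_congr rfl fun i _ => (map_smulₛₗ _ _ _).symm
  have hinj : Function.Injective τ := by
    refine (LinearMap.injective_iff_surjective_of_finrank_eq_finrank ?_).mpr
      (LinearMap.range_eq_top.mp hsurj)
    rw [Module.finrank_fintype_fun_eq_card, card_basis_forms b', finrank_forms]
  have hcol : (fun j => evForms φ d (T (b j))) =
      τ ∘ ((LinearMap.toMatrix b b' T).map φ).col := by
    funext j
    rw [Function.comp_apply, Fintype.linearCombination_apply, ← b'.sum_repr (T (b j)), map_sum]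
    refine Finset.sum_congr rfl fun i _ => ?_
    rw [map_smulₛₗ, ← LinearMap.toMatrix_apply]
    rfl
  rw [Matrix.rank_eq_finrank_span_cols, (Submodule.equivMapOfInjective τ hinj _).finrank_eq,
    Submodule.map_span, ← Set.range_comp, hcol]

theorem corank_toMatrix_map (T : N →ₗ[A] forms A (d : ℤ)) {h : MvPolynomial (Fin 2) K} {e : ℕ}
    (hh : h.IsHomogeneous e) (h0 : h ≠ 0) (hed : e ≤ d)
    (hT : Submodule.span K (Set.range fun j => evForms φ d (T (b j))) = dvdForms h d) :
    corank ((LinearMap.toMatrix b b' T).map φ) = e := by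
  rw [corank, rank_toMatrix_map, hT, card_basis_forms b']
  have := finrank_dvdForms hh h0 hed
  omega

end Specialization

/-! ### The equations of the fibers -/

section FiberEquations

variable {k : Type*} [Field k] {r : ℕ} {f : Fin r → MvPolynomial (Fin 2) k}
  {μ : Fin (r - 1) → ℕ} {Φ : Matrix (Fin r) (Fin (r - 1)) (MvPolynomial (Fin 2) k)}
  {K : Type*} [Field K] [Algebra k K] (p : Fin r → K)

/-- The specialization of `L_l` at a point. -/
def fiberEquation (Φ : Matrix (Fin r) (Fin (r - 1)) (MvPolynomial (Fin 2) k)) (p : Fin r → K)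
    (l : Fin (r - 1)) : MvPolynomial (Fin 2) K :=
  ∑ i, MvPolynomial.map (algebraMap k K) (Φ i l) * C (p i)

theorem map_symEquation (l : Fin (r - 1)) :
    MvPolynomial.map (aeval p : MvPolynomial (Fin r) k →ₐ[k] K).toRingHom (symEquation Φ l) =
      fiberEquation Φ p l := by
  rw [symEquation, fiberEquation, map_sum]
  refine Finset.sum_congr rfl fun i _ => ?_
  rw [map_mul, MvPolynomial.map_map, MvPolynomial.map_C]
  congr 2
  · congr 1
    ext c
    simp
  · simp

theorem IsSyzygyBasis.fiberEquation_isHomogeneous (hΦ : IsSyzygyBasis f μ Φ) (l : Fin (r - 1)) :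
    (fiberEquation Φ p l).IsHomogeneous (μ l) := by
  refine IsHomogeneous.sum _ _ _ fun i _ => ?_
  rw [mul_comm]
  exact ((hΦ.homogeneous i l).map _).C_mul _

/-- Up to a power of `x` or `y`, the minors of `(f; p)` are combinations of the equations `ℓ`. -/
theorem IsSyzygyBasis.X_pow_mul_minor_mem (hΦ : IsSyzygyBasis f μ Φ) {x : Fin 2} {N : ℕ}
    (hN : X x ^ N ∈ Ideal.span (Set.range f)) (i j : Fin r) :
    X x ^ N * (p i • MvPolynomial.map (algebraMap k K) (f j) -
      p j • MvPolynomial.map (algebraMap k K) (f i)) ∈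
        Ideal.span (Set.range (fiberEquation Φ p)) := by
  obtain ⟨s, hs⟩ := Ideal.mem_span_range_iff_exists_fun.mp hN
  obtain ⟨w, hw, -, -⟩ := hΦ.exists_splitting hs
  set q : MvPolynomial (Fin 2) k →+* MvPolynomial (Fin 2) K := MvPolynomial.map (algebraMap k K)
    with hq
  have key : ∀ a, X x ^ N * C (p a) = q (f a) * (∑ i', q (s i') * C (p i')) +
      ∑ l, q (w a l) * fiberEquation Φ p l := by
    intro a
    have h1 : ∀ i', (if a = i' then X x ^ N else 0 : MvPolynomial (Fin 2) K) * C (p i') =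
        q (f a) * (q (s i') * C (p i')) + ∑ l, q (w a l) * (q (Φ i' l) * C (p i')) := by
      intro i'
      have := congrArg q (hw a i')
      rw [apply_ite q, map_zero, map_pow, map_add, map_mul, map_sum, hq, MvPolynomial.map_X,
        ← hq] at this
      rw [this, add_mul, Finset.sum_mul, mul_assoc]
      congr 1
      exact Finset.sum_congr rfl fun l _ => by rw [map_mul, mul_assoc]
    have h2 := Finset.sum_congr (rfl : (Finset.univ : Finset (Fin r)) = _) fun i' _ => h1 i'
    simp only [ite_mul, zero_mul, Finset.sum_ite_eq, Finset.mem_univ, if_true,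
      Finset.sum_add_distrib, ← Finset.mul_sum] at h2
    rw [h2, Finset.sum_comm]
    simp only [fiberEquation, Finset.mul_sum]
    rfl
  -- The common factor `∑ s_{i'} p_{i'}` is eliminated between the relations `key i` and `key j`.
  have : X x ^ N * (p i • q (f j) - p j • q (f i)) =
      ∑ l, (q (f j) * q (w i l) - q (f i) * q (w j l)) * fiberEquation Φ p l := by
    simp only [sub_mul, Finset.sum_sub_distrib, mul_assoc, ← Finset.mul_sum, smul_eq_C_mul]
    linear_combination q (f j) * key i - q (f i) * key j
  rw [this]
  exact Ideal.sum_mem _ fun l _ => Ideal.mul_mem_left _ _ (Ideal.subset_span ⟨l, rfl⟩)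

/-- As `∑ Φ_{jl} f_j = 0`, the product `f_i ∑ Φ_{jl} p_j` equals `∑ Φ_{jl} (p_j f_i - p_i f_j)`. -/
theorem IsSyzygyBasis.mul_fiberEquation_mem (hΦ : IsSyzygyBasis f μ Φ) (i : Fin r)
    (l : Fin (r - 1)) :
    MvPolynomial.map (algebraMap k K) (f i) * fiberEquation Φ p l ∈
      Ideal.span (Set.range fun j => p i • MvPolynomial.map (algebraMap k K) (f j) -
        p j • MvPolynomial.map (algebraMap k K) (f i)) := by
  set q : MvPolynomial (Fin 2) k →+* MvPolynomial (Fin 2) K := MvPolynomial.map (algebraMap k K)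
  have h0 : ∑ j, q (Φ j l) * q (f j) = 0 := by
    simpa only [map_sum, map_mul, map_zero] using congrArg q (hΦ.col_sum l)
  have : q (f i) * fiberEquation Φ p l =
      ∑ j, (-q (Φ j l)) * (p i • q (f j) - p j • q (f i)) := by
    have : ∀ j, (-q (Φ j l)) * (p i • q (f j) - p j • q (f i)) =
        -C (p i) * (q (Φ j l) * q (f j)) + q (f i) * (q (Φ j l) * C (p j)) := by
      intro j
      simp only [smul_eq_C_mul]
      ring
    simp_rw [this]
    rw [Finset.sum_add_distrib, ← Finset.mul_sum, h0, mul_zero, zero_add, ← Finset.mul_sum]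
    rfl
  rw [this]
  exact Ideal.sum_mem _ fun j _ => Ideal.mul_mem_left _ _ (Ideal.subset_span ⟨j, rfl⟩)

/-- The ideal of coprime binary forms contains all forms of large degree. -/
theorem mem_span_of_X_pow_mem {ι : Type*} [Fintype ι] {L : ι → MvPolynomial (Fin 2) K} {m : ι → ℤ}
    (hL : ∀ j, L j ∈ forms K (m j)) {s : ℤ} (hs : ∀ j l, j ≠ l → m j + m l - 1 ≤ s) {N : ℕ}
    (hN : ∀ x, X x ^ N ∈ Ideal.span (Set.range L)) {g : MvPolynomial (Fin 2) K}
    (hg : g ∈ forms K s) : g ∈ Ideal.span (Set.range L) := by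
  refine mem_span_of_X_pow_mul_mem hL hs (fun c hc => ⟨N, ?_⟩) hg
    (Ideal.mul_mem_right _ _ (hN 0)) (Ideal.mul_mem_right _ _ (hN 1))
  obtain ⟨w, hw⟩ := Ideal.mem_span_range_iff_exists_fun.mp (hN 0)
  rw [← hw]
  exact isKoszul_of_sum_mul_eq hc

theorem mulMap_coe (hΦ : ∀ i j, (Φ i j).IsHomogeneous (μ j)) (ν : ℤ)
    (g : ∀ j, forms (MvPolynomial (Fin r) k) (ν - μ j)) :
    (mulMap hΦ ν g : MvPolynomial (Fin 2) (MvPolynomial (Fin r) k)) =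
      ∑ j, symEquation Φ j * g j := by
  simp [mulMap]

/-- The specialized values span the degree `ν` part of the ideal of the fiber equations, because
coefficients may be chosen to be forms and forms over `K` are spanned by specialized ones. -/
theorem IsSyzygyBasis.span_evForms_mulMap (hΦ : IsSyzygyBasis f μ Φ) {ν : ℤ}
    {n : Type*} (b : Module.Basis n (MvPolynomial (Fin r) k)
      (∀ j, forms (MvPolynomial (Fin r) k) (ν - μ j)))
    {h : MvPolynomial (Fin 2) K} (hdvd : ∀ l, h ∣ fiberEquation Φ p l)
    (hmem : ∀ a ∈ forms K ν, h ∣ a → a ∈ Ideal.span (Set.range (fiberEquation Φ p))) :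
    Submodule.span K (Set.range fun j =>
      evForms (aeval p : MvPolynomial (Fin r) k →ₐ[k] K).toRingHom ν
        (mulMap hΦ.homogeneous ν (b j))) = dvdForms h ν := by
  classical
  set φ := (aeval p : MvPolynomial (Fin r) k →ₐ[k] K).toRingHom with hφ
  have hev : ∀ g, (evForms φ ν (mulMap hΦ.homogeneous ν g) : MvPolynomial (Fin 2) K) =
      ∑ j, fiberEquation Φ p j * MvPolynomial.map φ (g j) := by
    intro g
    rw [coe_evForms, mulMap_coe, map_sum]
    exact Finset.sum_congr rfl fun j _ => by rw [map_mul, hφ, map_symEquation]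
  set V := Submodule.span K (Set.range fun j => evForms φ ν (mulMap hΦ.homogeneous ν (b j)))
  have hV : ∀ g, evForms φ ν (mulMap hΦ.homogeneous ν g) ∈ V := by
    intro g
    induction b.mem_span g using Submodule.span_induction with
    | mem g hg =>
      obtain ⟨j, rfl⟩ := hg
      exact Submodule.subset_span ⟨j, rfl⟩
    | zero => rw [map_zero, map_zero]; exact zero_mem _
    | add x y _ _ hx hy => rw [map_add, map_add]; exact add_mem hx hy
    | smul c x _ hx => rw [map_smul, map_smulₛₗ]; exact Submodule.smul_mem _ _ hx
  refine le_antisymm (Submodule.span_le.mpr ?_) fun a ha => ?_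
  · rintro _ ⟨j, rfl⟩
    rw [SetLike.mem_coe, mem_dvdForms, hev]
    exact Finset.dvd_sum fun l _ => Dvd.dvd.mul_right (hdvd l) _
  · rw [mem_dvdForms] at ha
    obtain ⟨c, hc, hsum⟩ := exists_forms_coeff (fun l => forms_iff_isHomogeneous.mpr
      (hΦ.fiberEquation_isHomogeneous p l)) a.2 (hmem a a.2 ha)
    have hmul : ∀ l (c : forms K (ν - μ l)), (c * fiberEquation Φ p l : MvPolynomial (Fin 2) K) ∈
        V.map (forms K ν).subtype := by
      intro l c
      have hc : c ∈ Submodule.span K (Set.range (evForms φ (ν - μ l))) := by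
        rw [span_range_evForms]
        trivial
      induction hc using Submodule.span_induction with
      | mem c hc =>
        obtain ⟨g, rfl⟩ := hc
        refine ⟨_, hV (Pi.single l g), ?_⟩
        rw [Submodule.subtype_apply, hev, Finset.sum_eq_single l]
        · rw [Pi.single_eq_same, coe_evForms, mul_comm]
        · intro j _ hj
          rw [Pi.single_eq_of_ne hj, Submodule.coe_zero, map_zero, mul_zero]
        · simp
      | zero => rw [Submodule.coe_zero, zero_mul]; exact zero_mem _
      | add x y _ _ hx hy => rw [Submodule.coe_add, add_mul]; exact add_mem hx hy
      | smul t x _ hx =>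
        rw [Submodule.coe_smul, smul_mul_assoc]
        exact Submodule.smul_mem _ _ hx
    have : (a : MvPolynomial (Fin 2) K) ∈ V.map (forms K ν).subtype := by
      rw [hsum]
      exact Submodule.sum_mem _ fun l _ => hmul l ⟨c l, hc l⟩
    obtain ⟨a', ha', h⟩ := this
    rwa [← Subtype.ext (a1 := a') (a2 := a) h]

/-- Otherwise all minors vanish and `f_i` divides every `f_j` over `K`, hence also `x ^ N` and `y ^
N`. It is then a unit, which is impossible as `d ≥ 1`; in other words, `ψ` is not constant. -/
theorem IsSyzygyBasis.exists_fiberEquation_ne_zero (hΦ : IsSyzygyBasis f μ Φ) {d : ℕ} (hd : 1 ≤ d)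
    (hf : ∀ i, (f i).IsHomogeneous d) {N : ℕ} (hN : ∀ x, X x ^ N ∈ Ideal.span (Set.range f))
    {i : Fin r} (hp : p i ≠ 0) : ∃ l, fiberEquation Φ p l ≠ 0 := by
  by_contra! H
  set q : MvPolynomial (Fin 2) k →+* MvPolynomial (Fin 2) K := MvPolynomial.map (algebraMap k K)
    with hq
  have hG : ∀ j, p i • q (f j) - p j • q (f i) = 0 := by
    intro j
    have h := hΦ.X_pow_mul_minor_mem p (hN 0) i j
    have h0 : Ideal.span (Set.range (fiberEquation Φ p)) = ⊥ := by
      rw [Ideal.span_eq_bot]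
      rintro _ ⟨l, rfl⟩
      exact H l
    rw [h0, Ideal.mem_bot, mul_eq_zero] at h
    exact h.resolve_left (pow_ne_zero _ (X_ne_zero _))
  have hdvd : ∀ j, q (f i) ∣ q (f j) := by
    intro j
    refine ⟨C ((p i)⁻¹ * p j), ?_⟩
    have h1 : (C (p i)⁻¹ * C (p i) : MvPolynomial (Fin 2) K) = 1 := by
      rw [← C_mul, inv_mul_cancel₀ hp, C_1]
    have := hG j
    simp only [smul_eq_C_mul] at this
    rw [C_mul]
    linear_combination (-q (f j)) * h1 + C (p i)⁻¹ * this
  have hX : ∀ x, q (f i) * 1 ∣ X x ^ N := by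
    intro x
    obtain ⟨s, hs⟩ := Ideal.mem_span_range_iff_exists_fun.mp (hN x)
    have := congrArg q hs
    rw [map_pow, hq, MvPolynomial.map_X, ← hq, map_sum] at this
    rw [mul_one, ← this]
    exact Finset.dvd_sum fun j _ => by rw [map_mul]; exact Dvd.dvd.mul_left (hdvd j) _
  obtain ⟨u, hu⟩ := hX 0
  obtain ⟨v, hv⟩ := hX 1
  refine not_isUnit_of_isHomogeneous hd ((hf i).map (algebraMap k K)) (isUnit_of_dvd_one ?_)
  exact dvd_of_X_pow_mul_dvd (N := N) (u := u) (v := v) (a := 1) (by rw [hu]; ring)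
    (by rw [hv]; ring)

end FiberEquations

/-! ### Comparison of the corank with the degree of the fiber. -/

section FiberDegree

variable {k : Type*} [Field k] {r d : ℕ} {f : Fin r → MvPolynomial (Fin 2) k}
  {μ : Fin (r - 1) → ℕ} {Φ : Matrix (Fin r) (Fin (r - 1)) (MvPolynomial (Fin 2) k)}

theorem IsSyzygyBasis.corank_eq_finrank (hΦ : IsSyzygyBasis f μ Φ) (hd : 1 ≤ d)
    (hf : ∀ i, (f i).IsHomogeneous d) {N : ℕ} (hN : ∀ x, X x ^ N ∈ Ideal.span (Set.range f))
    {ν : ℤ} (hν : ∀ i j, i ≠ j → (μ i + μ j : ℤ) ≤ ν) (hμ : ∀ j, (μ j : ℤ) ≤ ν)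
    {K : Type*} [Field K] [Algebra k K] (p : Fin r → K) (i : Fin r) (hp : p i ≠ 0)
    {m n : Type*} [Fintype m] [Fintype n] [DecidableEq n]
    (b : Module.Basis n (MvPolynomial (Fin r) k)
      (∀ j, forms (MvPolynomial (Fin r) k) (ν - μ j)))
    (b' : Module.Basis m (MvPolynomial (Fin r) k) (forms (MvPolynomial (Fin r) k) ν)) :
    Module.Finite K (FiberRing (fun j => MvPolynomial.map (algebraMap k K) (f j))
      (fun j => (hf j).map (algebraMap k K)) p i) ∧
    corank ((LinearMap.toMatrix b b' (mulMap hΦ.homogeneous ν)).map (aeval p)) =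
      Module.finrank K (FiberRing (fun j => MvPolynomial.map (algebraMap k K) (f j))
        (fun j => (hf j).map (algebraMap k K)) p i) := by
  obtain ⟨e, h, ℓ', hh, h0, ⟨j₀, hej₀⟩, hℓ', hforms, N', hN'⟩ :=
    exists_gcd_forms (hΦ.fiberEquation_isHomogeneous p)
      (hΦ.exists_fiberEquation_ne_zero p hd hf hN hp)
  have hdvd : ∀ l, h ∣ fiberEquation Φ p l := fun l => ⟨ℓ' l, by rw [hℓ', mul_comm]⟩
  obtain ⟨v, rfl⟩ : ∃ v : ℕ, ν = v := ⟨ν.toNat, by have := hμ j₀; omega⟩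
  have hmem : ∀ s : ℕ, v ≤ s → ∀ a ∈ forms K (s : ℤ), h ∣ a →
      a ∈ Ideal.span (Set.range (fiberEquation Φ p)) := by
    rintro s hs a ha ⟨c, rfl⟩
    have hc : c ∈ forms K (s - e) := by
      refine mem_forms_of_mul_mem (forms_iff_isHomogeneous.mpr hh) h0 ?_
      rwa [sub_add_cancel, mul_comm]
    -- The quotients have degrees `μ_j - e`, and `(μ_j - e) + (μ_l - e) - 1 ≤ s - e` because `μ_j +
    -- μ_l ≤ ν ≤ s`.
    have := mem_span_of_X_pow_mem hforms
      (fun j l hjl => by have := hν j l hjl; omega) hN' hc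
    obtain ⟨w, rfl⟩ := Ideal.mem_span_range_iff_exists_fun.mp this
    rw [Finset.mul_sum]
    refine Ideal.sum_mem _ fun l _ => ?_
    rw [show h * (w l * ℓ' l) = w l * fiberEquation Φ p l by rw [hℓ']; ring]
    exact Ideal.mul_mem_left _ _ (Ideal.subset_span ⟨l, rfl⟩)
  have hspan : ∀ g ∈ Ideal.span (Set.range (fiberEquation Φ p)), h ∣ g := fun g hg => by
    rw [← Ideal.mem_span_singleton]
    refine Ideal.span_le.mpr ?_ hg
    rintro _ ⟨l, rfl⟩
    exact Ideal.mem_span_singleton.mpr (hdvd l)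
  -- The products of a minor with `x ^ N` and with `y ^ N` lie in the ideal of the fiber equations,
  -- hence are divisible by `h`, and then so is the minor.
  have hG : ∀ j, h ∣ p i • MvPolynomial.map (algebraMap k K) (f j) -
      p j • MvPolynomial.map (algebraMap k K) (f i) := by
    intro j
    obtain ⟨u, hu⟩ := hspan _ (hΦ.X_pow_mul_minor_mem p (hN 0) i j)
    obtain ⟨w, hw⟩ := hspan _ (hΦ.X_pow_mul_minor_mem p (hN 1) i j)
    exact dvd_of_X_pow_mul_dvd hu.symm hw.symm
  have hNK : ∀ x, X x ^ N ∈ Ideal.span (Set.range fun j =>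
      MvPolynomial.map (algebraMap k K) (f j)) := by
    intro x
    have := Ideal.mem_map_of_mem (MvPolynomial.map (algebraMap k K)) (hN x)
    rwa [Ideal.map_span, ← Set.range_comp, map_pow, MvPolynomial.map_X] at this
  obtain ⟨hfin, hrank⟩ := finrank_fiberRing (fun j => (hf j).map (algebraMap k K)) i p hG hp hNK
    hd hh h0 (B := v) fun s hs a ha hda => by
      obtain ⟨w, rfl⟩ := Ideal.mem_span_range_iff_exists_fun.mp (hmem s hs a ha hda)
      rw [Finset.mul_sum]
      refine Ideal.sum_mem _ fun l _ => ?_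
      rw [mul_left_comm]
      exact Ideal.mul_mem_left _ _ (hΦ.mul_fiberEquation_mem p i l)
  refine ⟨hfin, hrank ▸ ?_⟩
  exact corank_toMatrix_map (aeval p : MvPolynomial (Fin r) k →ₐ[k] K).toRingHom b b' _ hh h0
    (by have := hμ j₀; omega) (hΦ.span_evForms_mulMap p b hdvd (hmem v le_rfl))

end FiberDegree

end CurveFibers
end

theorem proposition4p1 {k : Type*} [Field k] {r d : ℕ} (hd : 1 ≤ d)
    (f : Fin r → MvPolynomial (Fin 2) k) (hf : ∀ i, (f i).IsHomogeneous d)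
    (hcop : ∀ g : MvPolynomial (Fin 2) k, (∀ i, g ∣ f i) → IsUnit g)
    (μ : Fin (r - 1) → ℕ) (Φ : Matrix (Fin r) (Fin (r - 1)) (MvPolynomial (Fin 2) k))
    (hΦ : CurveFibers.IsSyzygyBasis f μ Φ)
    (ν : ℤ) (hν : ∀ i j, i ≠ j → (μ i + μ j : ℤ) ≤ ν) (hν2 : r = 2 → (d : ℤ) ≤ ν) :
    (Subsingleton (CurveFibers.localH0 (X 0 : MvPolynomial (Fin 2) k) (X 1) (CurveFibers.symPiece f) ν) ∧
      Subsingleton (CurveFibers.LocalH1 (X 0 : MvPolynomial (Fin 2) k) (X 1) (CurveFibers.symPiece f) ν)) ∧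
    ∀ (K : Type*) [Field K] [Algebra k K] (p : Fin r → K) (i : Fin r), p i ≠ 0 →
      ∀ (m n : Type*) [Fintype m] [Fintype n] [DecidableEq n]
        (b : Module.Basis n (MvPolynomial (Fin r) k)
          (∀ j, CurveFibers.forms (MvPolynomial (Fin r) k) (ν - μ j)))
        (b' : Module.Basis m (MvPolynomial (Fin r) k)
          (CurveFibers.forms (MvPolynomial (Fin r) k) ν)),
        Module.Finite K (CurveFibers.FiberRing (fun j => map (algebraMap k K) (f j))
          (fun j => (hf j).map (algebraMap k K)) p i) ∧
        CurveFibers.corank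
            ((LinearMap.toMatrix b b' (CurveFibers.mulMap hΦ.homogeneous ν)).map (aeval p)) =
          Module.finrank K (CurveFibers.FiberRing (fun j => map (algebraMap k K) (f j))
            (fun j => (hf j).map (algebraMap k K)) p i) := by
  obtain ⟨N, hN⟩ := CurveFibers.exists_X_pow_mem hf hcop
  have h0 : ∃ i, f i ≠ 0 := by
    by_contra! H
    exact not_isUnit_zero (hcop 0 fun i => (H i).symm ▸ dvd_rfl)
  have hμ := hΦ.degree_le hf h0 hν hν2
  exact ⟨⟨hΦ.subsingleton_localH0 (hN 0) hν, hΦ.subsingleton_localH1 hμ⟩,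
    fun K _ _ p i hp m n _ _ _ b b' => hΦ.corank_eq_finrank hd hf hN hν hμ p i hp b b'⟩
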